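/- Let $\beta,r,R\in\mathbb R$. There is a constant $C>0$, depending only on $\beta,r,R$, such that the following holds for every $k$ and every $m\ge 2$, with $\epsilon(k,m):=C\sqrt{k\log m/m}$. Consider the extended stochastic ball model (ESBM) with $k$ balls in $\mathbb R^m$: for each $i\in[k]$ let $c_i\in\mathbb R^m$, $r_i>0$ and $\beta_i\ge 1$, let $\mu_i$ be a Borel probability measure on the closed ball $B_i$ with center $c_i$ and radius $r_i$, and, for a positive integer $n$ such that all $n_i:=\beta_i n$ are integers, draw $n_i$ random points according to $\mu_i$, for all $i\in[k]$, all these points being independent. Assume that for every $i\in[k]$ - (a1) $\mu_i$ is invariant under rotations centered in $c_i$; - (a2) every (relatively) open subset of $B_i$ containing $c_i$ has positive $\mu_i$-measure; - (a3) every subset of $B_i$ of zero Lebesgue measure has zero $\mu_i$-measure; and that $r_i\in[r,R]$ and $\beta_i\le\beta$. If $$d(c_i,c_j)>(1+\beta)R+\max\{r_i,r_j\}+\epsilon(k,m)\qquad\text{for all } i\ne j,$$ where $d$ is the Euclidean distance, then the linear program $$\min \sum_{p,q\in P} d(p,q)z_{pq}\quad\text{s.t.}\quad \sum_{p\in P}z_{pq}=1\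 \ \forall q\in P,\quad z_{pq}\le y_p\ \ \forall p,q\in P,\quad \sum_{p\in P}y_p=k,\quad y_p,z_{pq}\ge 0\ \ \forall p,q\in P,$$ with $P$ the family of all sampled points, achieves exact recovery with high probability. Here *exact recovery* means that the linear program has a unique optimal solution, that this solution has all its entries in $\{0,1\}$, and that it assigns each point to the ball from which it is drawn (for each $i$ there is a sampled point $a_i$ drawn from $B_i$ with $z_{a_iq}=1$ for all $q$ drawn from $B_i$). *With high probability* means that for every $\delta\in(0,1)$ there is $N$, which may depend on all the data of the model, such that the event has probability $>1-\delta$ for every admissible $n>N$. -/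

import Mathlib

open MeasureTheory

noncomputable section

namespace KMedian

/-! ## The `k`-median linear program -/

section LP

variable {ι : Type*} [Fintype ι]

/-- Feasibility for the linear programming relaxation. The points are indexed by `ι`; `y p` is the
weight of `p` as a center, and `z p q` is the amount to which `q` is assigned to `p`. -/
structure LPFeasible (k : ℕ) (y : ι → ℝ) (z : ι → ι → ℝ) : Prop where
  assign : ∀ q, ∑ p, z p q = 1
  le_center : ∀ p q, z p q ≤ y p
  card_centers : ∑ p, y p = k
  y_nonneg : ∀ p, 0 ≤ y p
  z_nonneg : ∀ p q, 0 ≤ z p q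

/-- Feasibility for the integer program. -/
structure IPFeasible (k : ℕ) (y : ι → ℝ) (z : ι → ι → ℝ) : Prop where
  assign : ∀ q, ∑ p, z p q = 1
  le_center : ∀ p q, z p q ≤ y p
  card_centers : ∑ p, y p = k
  y_binary : ∀ p, y p = 0 ∨ y p = 1
  z_binary : ∀ p q, z p q = 0 ∨ z p q = 1

/-- The common objective of the two programs, for the points `x p`, `p : ι`. -/
def objective {X : Type*} [Dist X] (x : ι → X) (z : ι → ι → ℝ) : ℝ :=
  ∑ p, ∑ q, dist (x p) (x q) * z p q

/-- `(y, z)` is an optimal solution of the linear program. -/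
def IsLPOptimal {X : Type*} [Dist X] (k : ℕ) (x : ι → X) (y : ι → ℝ) (z : ι → ι → ℝ) : Prop :=
  LPFeasible k y z ∧ ∀ y' z', LPFeasible k y' z' → objective x z ≤ objective x z'

end LP

/-! ## The extended stochastic ball model -/

/-- The data of the extended stochastic ball model with `k` balls in `ℝᵐ`: ball `i` has center
`center i` and positive radius `radius i`, and carries the Borel probability measure `μ i`
(a measure on `ℝᵐ` that gives mass zero to the complement of the closed ball); `β i ≥ 1` is the
ratio of the number of points drawn from ball `i` to the parameter `n`. -/
structure ESBM (k m : ℕ) where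
  center : Fin k → EuclideanSpace ℝ (Fin m)
  radius : Fin k → ℝ
  radius_pos : ∀ i, 0 < radius i
  β : Fin k → ℝ
  one_le_β : ∀ i, 1 ≤ β i
  μ : Fin k → Measure (EuclideanSpace ℝ (Fin m))
  isProbabilityMeasure : ∀ i, IsProbabilityMeasure (μ i)
  μ_compl_ball : ∀ i, μ i (Metric.closedBall (center i) (radius i))ᶜ = 0

attribute [instance] ESBM.isProbabilityMeasure

/-- Indices of the sampled points, when `ν i` points are drawn from ball `i`: the pair `⟨i, ℓ⟩`
stands for the `ℓ`-th point drawn from ball `i`. -/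
abbrev PointIndex {k : ℕ} (ν : Fin k → ℕ) : Type := Σ i : Fin k, Fin (ν i)

/-- Realizations of the sample. -/
abbrev Sample {k : ℕ} (m : ℕ) (ν : Fin k → ℕ) : Type :=
  PointIndex ν → EuclideanSpace ℝ (Fin m)

namespace ESBM

variable {k m : ℕ}

/-- The joint law of the sampled points: they are independent, and those of ball `i` have
law `μ i`. -/
def law (M : ESBM k m) (ν : Fin k → ℕ) : Measure (Sample m ν) :=
  Measure.pi fun p : PointIndex ν => M.μ p.1

/-- Each `μ i` is invariant under the rotations centered in `center i`. -/
def RotationInvariant (M : ESBM k m) : Prop :=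
  ∀ i, ∀ g : EuclideanSpace ℝ (Fin m) ≃ₗᵢ[ℝ] EuclideanSpace ℝ (Fin m),
    LinearMap.det g.toLinearEquiv.toLinearMap = 1 →
      (M.μ i).map (fun x => M.center i + g (x - M.center i)) = M.μ i

/-- Every relatively open subset of ball `i` that contains `center i` has positive probability. -/
def PosNearCenter (M : ESBM k m) : Prop :=
  ∀ i, ∀ U : Set (EuclideanSpace ℝ (Fin m)), IsOpen U → M.center i ∈ U →
    0 < M.μ i (U ∩ Metric.closedBall (M.center i) (M.radius i))

/-- Every Lebesgue null subset of ball `i` has probability zero. -/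
def NullOfLebesgueNull (M : ESBM k m) : Prop :=
  ∀ i, ∀ s ⊆ Metric.closedBall (M.center i) (M.radius i), volume s = 0 → M.μ i s = 0

/-- The property `A` of the sample holds with high probability as `n → ∞`, where `n_i = β_i n`
points are drawn from ball `i`; the `n` under consideration are those for which all the `β_i n` are
integers. (For a measurable `A`, the last line just says that `A` has probability `> 1 - δ`.) -/
def WithHighProbability (M : ESBM k m) (A : ∀ ν : Fin k → ℕ, Set (Sample m ν)) : Prop :=
  ∀ δ ∈ Set.Ioo (0 : ℝ) 1, ∃ N : ℕ, ∀ n : ℕ, N < n →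
    ∀ ν : Fin k → ℕ, (∀ i, (ν i : ℝ) = M.β i * n) →
      ∃ S ⊆ A ν, MeasurableSet S ∧ 1 - δ < (M.law ν).real S

end ESBM

/-- The linear program achieves exact recovery on the sample `x`: it has a unique optimal solution,
that solution is feasible for the integer program, and it assigns each point to the ball from which
it is drawn, i.e. in each ball `i` there is a point `a i` of the sample such that the points drawn
from ball `i` are assigned to `a i`. -/
def ExactRecovery {k m : ℕ} {ν : Fin k → ℕ} (x : Sample m ν) : Prop :=
  ∃ (y : PointIndex ν → ℝ) (z : PointIndex ν → PointIndex ν → ℝ),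
    IsLPOptimal k x y z ∧
    (∀ y' z', IsLPOptimal k x y' z' → y' = y ∧ z' = z) ∧
    IPFeasible k y z ∧
    ∃ a : Fin k → PointIndex ν, (∀ i, (a i).1 = i) ∧ ∀ q, z (a q.1) q = 1

end KMedian

end

/-!
The planted assignment is certified by linear programming duality. A dual solution consists of a
number `α q` for each point `q` and a number `ω` such that the contributions `(α q - d(p, q))₊` to
each point `p` add up to at most `ω`. If this holds with equality for one point `a i` of each ball,
and strictly for the other points, and if the contributions to `a i` come exactly from its own ball,
then assigning the points of ball `i` to `a i` is the unique optimal solution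
(`exists_unique_optimal_of_certificate`).

Take `ω = n * β * R`, and let `α` be constant on each ball, equal to `α j ≈ ρ j + β * R / β j`, where
`ρ j` is the mean distance of a random point of ball `j` to the center. In expectation, the dual
constraint is then an equality at the centers of the balls. Let `p` be a point of ball `i` at
distance `t` from the center.

* The own ball contributes less to `p` than to the center, by at least `t ^ 2 / (12 * R)` per point
  (`IsRotationInvariant.integral_pos_part_le`). This follows by averaging over antipodal pairs `±x`,
  for which `(‖p - x‖ + ‖p + x‖) / 2` exceeds `‖x‖` by a multiple of the squared distance from `p` to
  the line through `x`; since `α i ≥ ρ i + R`, truncation does not destroy this gain.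
* Another ball `j` contributes only to the extent that the coordinate of its points in the direction
  of `p` exceeds `σ = R - t + ε`. This coordinate has second moment at most `R ^ 2 / m`, because a
  rotation invariant distribution is isotropic. So the mean contribution is at most
  `R ^ 3 / (m * σ ^ 2)`, and it vanishes for `t ≤ ε`. As `σ * t ≥ ε * R` for `ε ≤ t ≤ R`, the
  contributions of the `k` balls together are at most `t ^ 2 / (24 * R)` as soon as
  `m * ε ^ 2 ≥ 24 * β * k * R ^ 2` (`ESBM.sum_integral_contribution_le`).

So the mean dual constraint of `p` has slack `t ^ 2 / (24 * R)`. The sample inherits this slack for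
`t` bounded away from zero, by Chebyshev's inequality on a finite net. For `t` close to zero, the
contributions of the own ball are not truncated and the others vanish, so that the dual constraint
merely compares the cost of `p` within its cluster with that of the best point `a i`, which lies
close to the center as well. This comparison is strict because almost surely no two points have the
same cost (`ESBM.law_clusterCost_eq`): the level sets of a sum of distances are null sets in
dimension at least two. All this is put together for one sample in `exactRecovery_of_deviation_le`.
-/

namespace KMedian

/-! ### Optimality certificates for the linear program -/

section Certificate

variable {ι X : Type*} [Fintype ι] [Dist X] {k : ℕ}

/-- The Lagrangian form of the objective: multipliers `α q` for the assignment constraints and `ω`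
for the number of centers. -/
theorem objective_eq_lagrangian {x : ι → X} {y : ι → ℝ} {z : ι → ι → ℝ} (h : LPFeasible k y z)
    (α : ι → ℝ) (ω : ℝ) :
    objective x z = (∑ q, α q - k * ω)
      + ∑ p, (∑ q, (dist (x p) (x q) - α q) * z p q + ω * y p) := by
  have h1 : ∑ p, ∑ q, α q * z p q = ∑ q, α q := by
    rw [Finset.sum_comm]
    exact Finset.sum_congr rfl fun q _ => by rw [← Finset.mul_sum, h.assign, mul_one]
  have h2 : ∑ p, ω * y p = k * ω := by rw [← Finset.mul_sum, h.card_centers, mul_comm]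
  simp only [objective, sub_mul, Finset.sum_add_distrib, Finset.sum_sub_distrib, h1, h2]
  ring

/-- With `a` the gain `α q - dist (x p) (x q)`, the constraints `0 ≤ z p q ≤ y p` bound the gain
collected by `z p q` by the truncated gain times `y p`. -/
theorem pos_part_mul_add_nonneg {y z a : ℝ} (hz : 0 ≤ z) (hzy : z ≤ y) :
    0 ≤ -a * z + max a 0 * y := by
  rcases le_total a 0 with ha | ha
  · rw [max_eq_right ha]; nlinarith
  · rw [max_eq_left ha]; nlinarith

/-- The terms of the Lagrangian, split into the slack of the bound in `pos_part_mul_add_nonneg` and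
the slack of the dual constraint of `p`. -/
theorem lagrangian_term_eq (x : ι → X) (y : ι → ℝ) (z : ι → ι → ℝ) (α : ι → ℝ) (ω : ℝ) (p : ι) :
    ∑ q, (dist (x p) (x q) - α q) * z p q + ω * y p
      = ∑ q, (-(α q - dist (x p) (x q)) * z p q + max (α q - dist (x p) (x q)) 0 * y p)
        + y p * (ω - ∑ q, max (α q - dist (x p) (x q)) 0) := by
  rw [Finset.sum_add_distrib, ← Finset.sum_mul]
  have : ∀ q, (dist (x p) (x q) - α q) * z p q = -(α q - dist (x p) (x q)) * z p q := by
    intro q; ring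
  simp only [this]
  ring

/-- **Dual certificate.** The points are divided into clusters by `cl`, and cluster `i` has the
designated center `a i`. If `(α, ω)` is feasible for the dual program, with equality in the dual
constraint of `p` exactly when `p` is a designated center, and `α` is complementary to the
assignment of each point to the designated center of its cluster, strictly so for the other
designated centers, then this assignment is the unique optimal solution. -/
theorem exists_unique_optimal_of_certificate (x : ι → X) (cl : ι → Fin k) (a : Fin k → ι)
    (ha : ∀ i, cl (a i) = i) (α : ι → ℝ) (ω : ℝ)
    (heq : ∀ i, ∑ q, max (α q - dist (x (a i)) (x q)) 0 = ω)
    (hlt : ∀ p, (∀ i, p ≠ a i) → ∑ q, max (α q - dist (x p) (x q)) 0 < ω)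
    (hin : ∀ q, dist (x (a (cl q))) (x q) ≤ α q)
    (hout : ∀ i q, cl q ≠ i → α q < dist (x (a i)) (x q)) :
    ∃ (y : ι → ℝ) (z : ι → ι → ℝ), IsLPOptimal k x y z ∧
      (∀ y' z', IsLPOptimal k x y' z' → y' = y ∧ z' = z) ∧
      IPFeasible k y z ∧ ∀ q, z (a (cl q)) q = 1 := by
  classical
  set y : ι → ℝ := fun p => if p = a (cl p) then 1 else 0 with hy
  set z : ι → ι → ℝ := fun p q => if p = a (cl q) then 1 else 0 with hz
  have hya : ∀ i, y (a i) = 1 := fun i => by simp [hy, ha]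
  have hIP : IPFeasible k y z := by
    refine ⟨fun q => by simp [hz], fun p q => ?_, ?_, fun p => ?_, fun p q => ?_⟩
    · by_cases h : p = a (cl q)
      · simp [hz, hy, h, ha]
      · simp only [hz, hy, h, if_false]; split_ifs <;> norm_num
    · have : ∀ p, y p = ∑ i, if p = a i then 1 else 0 := fun p => by
        rw [Finset.sum_eq_single (cl p)]
        · intro i _ hi
          rw [if_neg]
          rintro rfl
          exact hi (ha i).symm
        · simp
      simp only [this]
      rw [Finset.sum_comm]
      simp
    · by_cases h : p = a (cl p)
      · right; simp only [hy]; rw [if_pos h]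
      · left; simp only [hy]; rw [if_neg h]
    · by_cases h : p = a (cl q)
      · right; simp [hz, h]
      · left; simp [hz, h]
  have hLP : LPFeasible k y z := by
    refine ⟨hIP.assign, hIP.le_center, hIP.card_centers, fun p => ?_, fun p q => ?_⟩
    · rcases hIP.y_binary p with h | h <;> rw [h]; norm_num
    · rcases hIP.z_binary p q with h | h <;> rw [h]; norm_num
  have hle : ∀ p, ∑ q, max (α q - dist (x p) (x q)) 0 ≤ ω := fun p => by
    by_cases h : ∀ i, p ≠ a i
    · exact (hlt p h).le
    · push Not at h
      obtain ⟨i, rfl⟩ := h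
      exact (heq i).le
  have hobj : objective x z = ∑ q, α q - k * ω := by
    have h1 : objective x z = ∑ q, dist (x (a (cl q))) (x q) := by
      rw [objective, Finset.sum_comm]
      refine Finset.sum_congr rfl fun q _ => ?_
      simp [hz]
    have h2 : ∑ q, (α q - dist (x (a (cl q))) (x q)) = k * ω := by
      have : ∑ i : Fin k, ∑ q, max (α q - dist (x (a i)) (x q)) 0 = k * ω := by
        simp [heq]
      rw [← this, Finset.sum_comm]
      refine Finset.sum_congr rfl fun q _ => ?_
      rw [Finset.sum_eq_single (cl q)]
      · rw [max_eq_left]; linarith [hin q]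
      · intro i _ hi
        rw [max_eq_right]; linarith [hout i q hi.symm]
      · simp
    rw [Finset.sum_sub_distrib] at h2
    linarith
  have hterm : ∀ {y' z'}, LPFeasible k y' z' → ∀ p q,
      0 ≤ -(α q - dist (x p) (x q)) * z' p q + max (α q - dist (x p) (x q)) 0 * y' p :=
    fun h p q => pos_part_mul_add_nonneg (h.z_nonneg p q) (h.le_center p q)
  have hterm2 : ∀ {y' z'}, LPFeasible k y' z' → ∀ p,
      0 ≤ ∑ q, (dist (x p) (x q) - α q) * z' p q + ω * y' p := fun h p => by
    rw [lagrangian_term_eq]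
    exact add_nonneg (Finset.sum_nonneg fun q _ => hterm h p q)
      (mul_nonneg (h.y_nonneg p) (sub_nonneg.2 (hle p)))
  have hopt : IsLPOptimal k x y z := by
    refine ⟨hLP, fun y' z' h => ?_⟩
    rw [hobj, objective_eq_lagrangian h α ω]
    linarith [Finset.sum_nonneg fun p (_ : p ∈ Finset.univ) => hterm2 h p]
  refine ⟨y, z, hopt, fun y' z' h' => ?_, hIP, fun q => by simp [hz]⟩
  have hf := h'.1
  have hz0 : ∀ p, ∑ q, (dist (x p) (x q) - α q) * z' p q + ω * y' p = 0 := by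
    have h1 : objective x z' = ∑ q, α q - k * ω :=
      (le_antisymm (h'.2 y z hLP) (hopt.2 y' z' hf)).trans hobj
    rw [objective_eq_lagrangian hf α ω] at h1
    have h2 := (Finset.sum_eq_zero_iff_of_nonneg fun p _ => hterm2 hf p).1 (by linarith)
    exact fun p => h2 p (Finset.mem_univ p)
  -- complementary slackness: only designated centers are used
  have hy0 : ∀ p, (∀ i, p ≠ a i) → y' p = 0 := fun p hp => by
    have h1 := hz0 p
    rw [lagrangian_term_eq] at h1
    have h2 := Finset.sum_nonneg fun q (_ : q ∈ Finset.univ) => hterm hf p q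
    have h3 := hlt p hp
    nlinarith [hf.y_nonneg p]
  have hzout : ∀ i q, cl q ≠ i → z' (a i) q = 0 := fun i q hq => by
    have h1 := hz0 (a i)
    rw [lagrangian_term_eq, heq, sub_self, mul_zero, add_zero] at h1
    have h2 := (Finset.sum_eq_zero_iff_of_nonneg fun q _ => hterm hf (a i) q).1 h1 q
      (Finset.mem_univ q)
    have h3 := hout i q hq
    rw [max_eq_right (by linarith), zero_mul, add_zero] at h2
    rcases mul_eq_zero.1 h2 with h | h
    · linarith
    · exact h
  have hzpq : ∀ p q, p ≠ a (cl q) → z' p q = 0 := fun p q hpq => by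
    by_cases h : ∀ i, p ≠ a i
    · exact le_antisymm ((hf.le_center p q).trans (hy0 p h).le) (hf.z_nonneg p q)
    · push Not at h
      obtain ⟨i, rfl⟩ := h
      exact hzout i q fun h => hpq (by rw [h])
  have hz1 : ∀ q, z' (a (cl q)) q = 1 := fun q => by
    rw [← hf.assign q, Finset.sum_eq_single (a (cl q))]
    · intro p _ hp; exact hzpq p q hp
    · simp
  have hyge : ∀ p, y p ≤ y' p := fun p => by
    by_cases h : p = a (cl p)
    · have h1 := hf.le_center (a (cl p)) p
      rw [hz1, ← h] at h1
      simp only [hy]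
      rwa [if_pos h]
    · simp only [hy]; rw [if_neg h]; exact hf.y_nonneg p
  have hyy : ∀ p, y p = y' p := fun p =>
    (Finset.sum_eq_sum_iff_of_le fun p _ => hyge p).1
      (hLP.card_centers.trans hf.card_centers.symm) p (Finset.mem_univ p)
  refine ⟨funext fun p => (hyy p).symm, funext fun p => funext fun q => ?_⟩
  by_cases h : p = a (cl q)
  · subst h; simp [hz, hz1]
  · simp [hz, h, hzpq p q h]

end Certificate

end KMedian

namespace KMedian

/-! ### Rotation invariant measures -/

section Rotation

variable {E : Type*} [NormedAddCommGroup E] [InnerProductSpace ℝ E]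

section

variable [MeasurableSpace E] [BorelSpace E] {μ : Measure E}

/-- The measure `μ` is invariant under the rotations centered at the origin. -/
def IsRotationInvariant (μ : Measure E) : Prop :=
  ∀ g : E ≃ₗᵢ[ℝ] E, LinearMap.det g.toLinearEquiv.toLinearMap = 1 → μ.map g = μ

theorem IsRotationInvariant.integral_comp (hμ : IsRotationInvariant μ) (g : E ≃ₗᵢ[ℝ] E)
    (hg : LinearMap.det g.toLinearEquiv.toLinearMap = 1) (f : E → ℝ) :
    ∫ x, f (g x) ∂μ = ∫ x, f x ∂μ := by
  conv_rhs => rw [← hμ g hg]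
  exact (g.toHomeomorph.measurableEmbedding.integral_map f).symm

end

variable [FiniteDimensional ℝ E]

theorem exists_ne_zero_inner_eq_zero (hE : 2 ≤ Module.finrank ℝ E) (u : E) :
    ∃ w : E, w ≠ 0 ∧ inner ℝ w u = 0 := by
  have h : (ℝ ∙ u)ᗮ ≠ ⊥ := fun h => by
    have h1 := Submodule.finrank_add_finrank_orthogonal (ℝ ∙ u)
    rw [h, finrank_bot] at h1
    have h2 := finrank_span_le_card (R := ℝ) ({u} : Set E)
    rw [Set.toFinset_singleton, Finset.card_singleton] at h2
    omega
  obtain ⟨w, hw, hw0⟩ := Submodule.exists_mem_ne_zero_of_ne_bot h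
  refine ⟨w, hw0, ?_⟩
  rw [real_inner_comm]
  exact Submodule.mem_orthogonal_singleton_iff_inner_right.1 hw

/-- Rotations act transitively on spheres in dimension at least two: the reflection that exchanges
`u` and `v` is corrected to determinant one by a reflection that fixes `u`. -/
theorem exists_rotation_apply_eq (hE : 2 ≤ Module.finrank ℝ E) {u v : E} (h : ‖u‖ = ‖v‖) :
    ∃ g : E ≃ₗᵢ[ℝ] E, LinearMap.det g.toLinearEquiv.toLinearMap = 1 ∧ g u = v := by
  by_cases huv : u = v
  · refine ⟨LinearIsometryEquiv.refl ℝ E, ?_, huv⟩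
    exact LinearMap.det_id
  obtain ⟨w, hw0, hw⟩ := exists_ne_zero_inner_eq_zero hE u
  have hdet : ∀ x : E, x ≠ 0 →
      LinearMap.det (ℝ ∙ x)ᗮ.reflection.toLinearEquiv.toLinearMap = -1 := fun x hx => by
    have := (ℝ ∙ x)ᗮ.det_reflection (𝕜 := ℝ)
    rw [Submodule.orthogonal_orthogonal, finrank_span_singleton hx, pow_one] at this
    exact this
  refine ⟨(ℝ ∙ w)ᗮ.reflection.trans (ℝ ∙ (u - v))ᗮ.reflection, ?_, ?_⟩
  · have : ((ℝ ∙ w)ᗮ.reflection.trans (ℝ ∙ (u - v))ᗮ.reflection).toLinearEquiv.toLinearMap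
        = (ℝ ∙ (u - v))ᗮ.reflection.toLinearEquiv.toLinearMap
          ∘ₗ (ℝ ∙ w)ᗮ.reflection.toLinearEquiv.toLinearMap := rfl
    rw [this, LinearMap.det_comp, hdet _ hw0, hdet _ (sub_ne_zero.2 huv)]
    norm_num
  · have hu : (ℝ ∙ w)ᗮ.reflection u = u :=
      Submodule.reflection_mem_subspace_eq_self
        (Submodule.mem_orthogonal_singleton_iff_inner_right.2 hw)
    rw [LinearIsometryEquiv.trans_apply, hu, Submodule.reflection_sub h]

variable [MeasurableSpace E] [BorelSpace E] {μ : Measure E}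

/-- Some rotation maps `p` to `-p`, so that `‖p + x‖` and `‖p - x‖` have the same distribution. -/
theorem IsRotationInvariant.integral_norm_add (hμ : IsRotationInvariant μ)
    (hE : 2 ≤ Module.finrank ℝ E) (f : ℝ → ℝ) (p : E) :
    ∫ x, f ‖p + x‖ ∂μ = ∫ x, f ‖p - x‖ ∂μ := by
  obtain ⟨g, hg, hgp⟩ := exists_rotation_apply_eq hE (norm_neg p)
  rw [← hμ.integral_comp g hg fun x => f ‖p - x‖]
  refine integral_congr_ae (Filter.Eventually.of_forall fun x => ?_)
  have : ‖p - g x‖ = ‖p + x‖ := by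
    conv_lhs => rw [← hgp, ← map_sub, LinearIsometryEquiv.norm_map, ← norm_neg]
    congr 1; abel
  simp only [this]

/-- A bounded equivariant image of a rotation invariant distribution is isotropic: its second moment
in every direction is its total second moment divided by the dimension. -/
theorem IsRotationInvariant.integral_inner_sq_le [IsProbabilityMeasure μ]
    (hμ : IsRotationInvariant μ) (hE : 2 ≤ Module.finrank ℝ E) {ψ : E → E} (hψ : Measurable ψ)
    (hequiv : ∀ (g : E ≃ₗᵢ[ℝ] E) x, ψ (g x) = g (ψ x)) {B : ℝ} (hB : ∀ᵐ x ∂μ, ‖ψ x‖ ≤ B) (v : E) :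
    Integrable (fun x => (inner ℝ v (ψ x)) ^ 2) μ ∧
      ∫ x, (inner ℝ v (ψ x)) ^ 2 ∂μ ≤ ‖v‖ ^ 2 * B ^ 2 / Module.finrank ℝ E := by
  have hint : ∀ v : E, Integrable (fun x => (inner ℝ v (ψ x) : ℝ) ^ 2) μ := fun v => by
    refine Integrable.of_bound (C := (‖v‖ * B) ^ 2)
      (((innerSL ℝ v).continuous.measurable.comp hψ).pow_const 2).aestronglyMeasurable ?_
    filter_upwards [hB] with x hx
    rw [Real.norm_eq_abs, abs_of_nonneg (sq_nonneg _), ← sq_abs]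
    exact pow_le_pow_left₀ (abs_nonneg _) ((abs_real_inner_le_norm _ _).trans
      (mul_le_mul_of_nonneg_left hx (norm_nonneg _))) 2
  refine ⟨hint v, ?_⟩
  have heq : ∀ u : E, ‖u‖ = ‖v‖ →
      ∫ x, (inner ℝ u (ψ x) : ℝ) ^ 2 ∂μ = ∫ x, (inner ℝ v (ψ x) : ℝ) ^ 2 ∂μ := fun u hu => by
    obtain ⟨g, hg, rfl⟩ := exists_rotation_apply_eq hE hu
    rw [← hμ.integral_comp g hg fun x => (inner ℝ (g u) (ψ x) : ℝ) ^ 2]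
    simp only [hequiv, LinearIsometryEquiv.inner_map_map]
  set b := stdOrthonormalBasis ℝ E
  have hsum : (Module.finrank ℝ E : ℝ) * ∫ x, (inner ℝ v (ψ x) : ℝ) ^ 2 ∂μ
      = ∫ x, ‖v‖ ^ 2 * ‖ψ x‖ ^ 2 ∂μ := by
    calc _ = ∑ i, ∫ x, (inner ℝ (‖v‖ • b i) (ψ x) : ℝ) ^ 2 ∂μ := by
          rw [Finset.sum_congr rfl fun i _ => heq (‖v‖ • b i) (by simp [norm_smul])]
          simp
      _ = ∫ x, ∑ i, (inner ℝ (‖v‖ • b i) (ψ x) : ℝ) ^ 2 ∂μ :=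
          (integral_finsetSum _ fun i _ => hint _).symm
      _ = _ := by
          congr 1 with x
          rw [← b.sum_sq_norm_inner_right (ψ x), Finset.mul_sum]
          refine Finset.sum_congr rfl fun i _ => ?_
          rw [real_inner_smul_left, mul_pow, Real.norm_eq_abs, sq_abs]
  have hle : ∫ x, ‖v‖ ^ 2 * ‖ψ x‖ ^ 2 ∂μ ≤ ‖v‖ ^ 2 * B ^ 2 := by
    have h1 : ∫ x, ‖v‖ ^ 2 * ‖ψ x‖ ^ 2 ∂μ ≤ ∫ _, ‖v‖ ^ 2 * B ^ 2 ∂μ := by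
      refine integral_mono_of_nonneg (Filter.Eventually.of_forall fun x => by positivity)
        (integrable_const _) ?_
      filter_upwards [hB] with x hx
      gcongr
    simpa using h1
  rw [le_div_iff₀ (by positivity)]
  linarith

end Rotation

/-! ### Mean truncated contributions of a rotation invariant distribution -/

section Norm

variable {E : Type*} [NormedAddCommGroup E] [MeasurableSpace E] {μ : Measure E}

theorem integrable_norm_of_ae_le [OpensMeasurableSpace E] [IsFiniteMeasure μ] {R : ℝ}
    (hsupp : ∀ᵐ x ∂μ, ‖x‖ ≤ R) :
    Integrable (fun x => ‖x‖) μ := by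
  refine Integrable.of_bound (C := R) continuous_norm.aestronglyMeasurable ?_
  filter_upwards [hsupp] with x hx
  simpa using hx

theorem integral_pos_part_eq_zero {r α : ℝ} {p : E} (hsupp : ∀ᵐ x ∂μ, ‖x‖ ≤ r)
    (hp : r + α ≤ ‖p‖) : ∫ x, max (α - ‖p - x‖) 0 ∂μ = 0 := by
  rw [integral_eq_zero_of_ae]
  filter_upwards [hsupp] with x hx
  have := norm_sub_norm_le p x
  exact max_eq_right (by linarith)

end Norm

section Expectation

/-- A scalar form of the parallelogram estimate: if `u₁` and `u₂` are the lengths of the diagonals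
of a parallelogram with sides `s` and `t`, then truncating both at a level `α` that exceeds the
sides costs at most `s + t - α`. -/
theorem sub_le_min_add_min {s t u₁ u₂ α : ℝ} (hs : 0 ≤ s) (ht : 0 ≤ t) (hsα : s ≤ α)
    (htα : t ≤ α) (h : u₁ ^ 2 + u₂ ^ 2 = 2 * (s ^ 2 + t ^ 2)) (h1 : u₁ ≤ s + t) (h2 : u₂ ≤ s + t) :
    u₁ + u₂ - max (s + t - α) 0 ≤ min α u₁ + min α u₂ := by
  have hL1 := le_max_left (s + t - α) 0
  have hL0 := le_max_right (s + t - α) 0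
  rcases le_total α u₁ with a1 | a1 <;> rcases le_total α u₂ with a2 | a2 <;>
    simp only [a1, a2, min_eq_left, min_eq_right]
  · have h3 : u₁ + u₂ ≤ α + s + t := by
      apply abs_le_of_sq_le_sq' _ (by linarith) |>.2
      nlinarith [sq_nonneg (u₁ - u₂), sq_nonneg (s - t), mul_nonneg hs ht]
    linarith
  all_goals linarith

variable {E : Type*} [NormedAddCommGroup E] [InnerProductSpace ℝ E]

/-- The average of `min α` over the distances from `p` to the antipodal points `x` and `-x` exceeds
`‖x‖` by a multiple of the squared distance from `p` to the line through `x`, up to a term that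
integrates to zero when `ρ` is the mean of `‖x‖`. -/
theorem le_min_norm_sub_add_min_norm_add {R ρ α : ℝ} (hR : 0 < R) (hα : ρ + R ≤ α) (hρ : 0 ≤ ρ)
    {p x : E} (hp : ‖p‖ ≤ R) (hx : ‖x‖ ≤ R) :
    2 * ‖x‖ + (‖p‖ ^ 2 - (inner ℝ p (‖x‖⁻¹ • x)) ^ 2) / (3 * R)
        - (if ρ ≤ ‖p‖ then 1 else 0) * (‖x‖ - ρ)
      ≤ min α ‖p - x‖ + min α ‖p + x‖ := by
  set s := ‖x‖ with hs
  set t := ‖p‖ with ht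
  set a : ℝ := inner ℝ p (‖x‖⁻¹ • x) with ha
  have hs0 : 0 ≤ s := norm_nonneg _
  have ht0 : 0 ≤ t := norm_nonneg _
  have hinner : inner ℝ p x = s * a := by
    rw [ha, real_inner_smul_right, ← mul_assoc]
    by_cases h0 : s = 0
    · have : x = 0 := norm_eq_zero.1 h0
      simp [this]
    · rw [mul_inv_cancel₀ h0, one_mul]
  have hat : a ^ 2 ≤ t ^ 2 := by
    rw [← sq_abs a]
    refine pow_le_pow_left₀ (abs_nonneg _) ((abs_real_inner_le_norm _ _).trans ?_) 2
    rw [norm_smul, norm_inv, norm_norm]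
    exact mul_le_of_le_one_right ht0 (inv_mul_le_one_of_le₀ le_rfl hs0)
  have e1 : ‖p - x‖ ^ 2 = t ^ 2 + s ^ 2 - 2 * (s * a) := by
    rw [norm_sub_sq_real, hinner]; ring
  have e2 : ‖p + x‖ ^ 2 = t ^ 2 + s ^ 2 + 2 * (s * a) := by
    rw [norm_add_sq_real, hinner]; ring
  have n1 := norm_nonneg (p - x)
  have n2 := norm_nonneg (p + x)
  have l1 : ‖p - x‖ ≤ s + t := by rw [add_comm]; exact norm_sub_le _ _
  have l2 : ‖p + x‖ ≤ s + t := by rw [add_comm]; exact norm_add_le _ _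
  have ht2 : 2 * t ≤ ‖p - x‖ + ‖p + x‖ := by
    have := norm_add_le (p - x) (p + x)
    rw [sub_add_add_cancel, ← two_smul ℝ p, norm_smul] at this
    simpa using this
  have hs2 : 2 * s ≤ ‖p - x‖ + ‖p + x‖ := by
    have := norm_sub_le (p + x) (p - x)
    rw [add_sub_sub_cancel, ← two_smul ℝ x, norm_smul] at this
    have h2 : ‖(2 : ℝ)‖ = 2 := by simp
    rw [h2] at this
    linarith
  generalize ‖p - x‖ = u₁ at *
  generalize ‖p + x‖ = u₂ at *
  have hprod : s ^ 2 + t ^ 2 - 2 * a ^ 2 ≤ u₁ * u₂ := by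
    apply abs_le_of_sq_le_sq' _ (by positivity) |>.2
    rw [mul_pow, e1, e2]
    nlinarith [mul_nonneg (sq_nonneg a) (sub_nonneg.2 hat)]
  obtain ⟨c, hc⟩ : ∃ c, c = (t ^ 2 - a ^ 2) / (3 * R) := ⟨_, rfl⟩
  have hcR : c * (3 * R) = t ^ 2 - a ^ 2 := by rw [hc]; field_simp
  have hc0 : 0 ≤ c := by
    rw [hc]; exact div_nonneg (by linarith) (by linarith)
  have hcle : c ≤ R / 3 := by
    have : c * (3 * R) ≤ R ^ 2 := by nlinarith [sq_nonneg a]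
    nlinarith
  have hA : 2 * s + 2 * c ≤ u₁ + u₂ := by
    apply abs_le_of_sq_le_sq' _ (by positivity) |>.2
    nlinarith [mul_nonneg hc0 (sub_nonneg.2 hx), mul_nonneg hc0 (sub_nonneg.2 hcle)]
  have hB := sub_le_min_add_min hs0 ht0 (by linarith : s ≤ α) (by linarith : t ≤ α)
    (by rw [e1, e2]; ring) l1 l2
  have hC : max (s + t - α) 0 ≤ max (t - s) 0 + (if ρ ≤ t then 1 else 0) * (s - ρ) := by
    have m1 := le_max_left (t - s) 0
    have m0 := le_max_right (t - s) 0
    split_ifs with h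
    · exact max_le (by linarith) (by linarith)
    · push Not at h
      exact max_le (by linarith) (by linarith)
  have hD : 2 * s + 2 * max (t - s) 0 ≤ u₁ + u₂ := by
    rcases max_cases (t - s) 0 with h | h <;> rw [h.1] <;> linarith
  rw [← hc]
  linarith

variable [FiniteDimensional ℝ E] [MeasurableSpace E] [BorelSpace E] {μ : Measure E}
  [IsProbabilityMeasure μ]

/-- Moving away from the center of a rotation invariant distribution decreases the expected
truncated contribution `(α - ‖p - x‖)₊` at least quadratically. -/
theorem IsRotationInvariant.integral_pos_part_le (hμ : IsRotationInvariant μ)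
    (hE : 2 ≤ Module.finrank ℝ E) {R α : ℝ} (hR : 0 < R) (hsupp : ∀ᵐ x ∂μ, ‖x‖ ≤ R)
    (hα : (∫ x, ‖x‖ ∂μ) + R ≤ α) {p : E} (hp : ‖p‖ ≤ R) :
    ∫ x, max (α - ‖p - x‖) 0 ∂μ ≤ α - (∫ x, ‖x‖ ∂μ) - ‖p‖ ^ 2 / (12 * R) := by
  set ρ := ∫ x, ‖x‖ ∂μ with hρ
  have hρ0 : 0 ≤ ρ := integral_nonneg fun _ => norm_nonneg _
  have hmin : ∀ f : E → ℝ, Continuous f → (∀ x, 0 ≤ f x) →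
      Integrable (fun x => min α (f x)) μ := fun f hf hf0 => by
    refine Integrable.of_bound (C := α) (continuous_const.min hf).aestronglyMeasurable ?_
    refine Filter.Eventually.of_forall fun x => ?_
    rw [Real.norm_eq_abs, abs_of_nonneg (le_min (by linarith) (hf0 x))]
    exact min_le_left _ _
  have hi1 := hmin (fun x => ‖p - x‖) (by fun_prop) fun _ => norm_nonneg _
  have hi2 := hmin (fun x => ‖p + x‖) (by fun_prop) fun _ => norm_nonneg _
  -- the direction of `x` makes an isotropic distribution, so on average at most half of `‖p‖ ^ 2` lies
  -- along it
  have hiso := hμ.integral_inner_sq_le hE (ψ := fun x => ‖x‖⁻¹ • x) (B := 1)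
    (measurable_norm.inv.smul measurable_id)
    (fun g x => by rw [LinearIsometryEquiv.norm_map, map_smul])
    (Filter.Eventually.of_forall fun x => by
      rw [norm_smul, norm_inv, norm_norm]; exact inv_mul_le_one_of_le₀ le_rfl (norm_nonneg _)) p
  have hin := integrable_norm_of_ae_le hsupp
  have hdim : ‖p‖ ^ 2 * 1 ^ 2 / (Module.finrank ℝ E : ℝ) ≤ ‖p‖ ^ 2 / 2 := by
    have : (2 : ℝ) ≤ Module.finrank ℝ E := by exact_mod_cast hE
    rw [one_pow, mul_one]
    gcongr
  have hsum : 2 * ρ + ‖p‖ ^ 2 / (6 * R) ≤ 2 * ∫ x, min α ‖p - x‖ ∂μ := by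
    have h1 := hμ.integral_norm_add hE (fun u => min α u) p
    have h2 : 2 * ∫ x, min α ‖p - x‖ ∂μ = ∫ x, (min α ‖p - x‖ + min α ‖p + x‖) ∂μ := by
      rw [integral_add hi1 hi2, h1]; ring
    rw [h2]
    set θ : ℝ := if ρ ≤ ‖p‖ then 1 else 0 with hθ
    have g1 : Integrable (fun x => 2 * ‖x‖) μ := hin.const_mul 2
    have g2 : Integrable
        (fun x => (‖p‖ ^ 2 - (inner ℝ p (‖x‖⁻¹ • x)) ^ 2) / (3 * R)) μ :=
      ((integrable_const _).sub hiso.1).div_const _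
    have g3 : Integrable (fun x => θ * (‖x‖ - ρ)) μ := (hin.sub (integrable_const _)).const_mul θ
    have h3 : ∫ x, (2 * ‖x‖ + (‖p‖ ^ 2 - (inner ℝ p (‖x‖⁻¹ • x)) ^ 2) / (3 * R)
        - θ * (‖x‖ - ρ)) ∂μ
        = 2 * ρ + (‖p‖ ^ 2 - ∫ x, (inner ℝ p (‖x‖⁻¹ • x)) ^ 2 ∂μ) / (3 * R) := by
      have g12 := integral_sub (g1.add g2) g3
      simp only [Pi.add_apply] at g12
      rw [g12, integral_add g1 g2, integral_const_mul, integral_const_mul,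
        integral_div, integral_sub (integrable_const _) hiso.1,
        integral_sub hin (integrable_const _)]
      simp [← hρ]
    have h4 : 2 * ρ + ‖p‖ ^ 2 / (6 * R)
        ≤ 2 * ρ + (‖p‖ ^ 2 - ∫ x, (inner ℝ p (‖x‖⁻¹ • x)) ^ 2 ∂μ) / (3 * R) := by
      have : ‖p‖ ^ 2 / (6 * R) = (‖p‖ ^ 2 / 2) / (3 * R) := by ring
      rw [this]
      have h5 := hiso.2.trans hdim
      gcongr
      linarith
    rw [← h3] at h4
    refine h4.trans (integral_mono_ae ((g1.add g2).sub g3) (hi1.add hi2) ?_)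
    filter_upwards [hsupp] with x hx
    exact le_min_norm_sub_add_min_norm_add hR hα hρ0 hp hx
  have hpm : ∀ x, max (α - ‖p - x‖) 0 = α - min α ‖p - x‖ := fun x => by
    rcases le_total α ‖p - x‖ with h | h
    · rw [min_eq_left h, max_eq_right (by linarith), sub_self]
    · rw [min_eq_right h, max_eq_left (by linarith)]
  simp only [hpm]
  rw [integral_sub (integrable_const _) hi1]
  have : ‖p‖ ^ 2 / (6 * R) = 2 * (‖p‖ ^ 2 / (12 * R)) := by ring
  simp only [integral_const, probReal_univ, smul_eq_mul, one_mul]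
  linarith

/-- A distant point `p` receives from a rotation invariant distribution of radius `r` an expected
contribution of order `1 / dim`, by Chebyshev's inequality in the direction of `p`. -/
theorem IsRotationInvariant.integral_pos_part_le_of_le_norm (hμ : IsRotationInvariant μ)
    (hE : 2 ≤ Module.finrank ℝ E) {r α σ : ℝ} (hsupp : ∀ᵐ x ∂μ, ‖x‖ ≤ r)
    (hr : 0 ≤ r) (hα : 0 ≤ α) (hσ : 0 < σ) {p : E} (hp : σ + α ≤ ‖p‖) :
    ∫ x, max (α - ‖p - x‖) 0 ∂μ ≤ r ^ 3 / (Module.finrank ℝ E * σ ^ 2) := by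
  have hp0 : 0 < ‖p‖ := by linarith
  set v := ‖p‖⁻¹ • p with hv
  have hv1 : ‖v‖ = 1 := by
    rw [hv, norm_smul, norm_inv, norm_norm, inv_mul_cancel₀ hp0.ne']
  have hvp : inner ℝ v p = ‖p‖ := by
    rw [hv, real_inner_smul_left, real_inner_self_eq_norm_sq, pow_two, ← mul_assoc,
      inv_mul_cancel₀ hp0.ne', one_mul]
  have hiso := hμ.integral_inner_sq_le hE (ψ := fun x => x) measurable_id (fun g x => rfl) hsupp v
  have h1 : ∫ x, max (α - ‖p - x‖) 0 ∂μ ≤ ∫ x, r / σ ^ 2 * (inner ℝ v x) ^ 2 ∂μ := by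
    refine integral_mono_of_nonneg (Filter.Eventually.of_forall fun x => le_max_right _ _)
      (hiso.1.const_mul _) ?_
    filter_upwards [hsupp] with x hx
    refine max_le ?_ (by positivity)
    have h2 : inner ℝ v (p - x) ≤ ‖p - x‖ := by
      have := real_inner_le_norm v (p - x)
      rwa [hv1, one_mul] at this
    have h3 : inner ℝ v x ≤ r := by
      have := real_inner_le_norm v x
      rw [hv1, one_mul] at this
      exact this.trans hx
    rw [inner_sub_right, hvp] at h2
    generalize (inner ℝ v x : ℝ) = X at *
    rcases le_total X σ with hX | hX
    · have : 0 ≤ r / σ ^ 2 * X ^ 2 := by positivity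
      linarith
    · have : r * 1 ≤ r * (X ^ 2 / σ ^ 2) := by
        gcongr
        rw [one_le_div (by positivity)]
        gcongr
      have e : r / σ ^ 2 * X ^ 2 = r * (X ^ 2 / σ ^ 2) := by ring
      linarith
  rw [integral_const_mul] at h1
  refine h1.trans ?_
  have hd : (0 : ℝ) < Module.finrank ℝ E := by
    have : 0 < Module.finrank ℝ E := by omega
    exact_mod_cast this
  calc r / σ ^ 2 * ∫ x, (inner ℝ v x) ^ 2 ∂μ
      ≤ r / σ ^ 2 * (‖v‖ ^ 2 * r ^ 2 / Module.finrank ℝ E) := by gcongr; exact hiso.2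
    _ = _ := by rw [hv1]; field_simp

end Expectation

end KMedian

namespace KMedian

/-! ### Ties between the costs of the sampled points -/

section Ties

variable {ι E : Type*} [NormedAddCommGroup E] [InnerProductSpace ℝ E]

theorem convexOn_sum_dist (T : Finset ι) (a : ι → E) :
    ConvexOn ℝ Set.univ fun y => ∑ q ∈ T, dist y (a q) := by
  induction T using Finset.cons_induction with
  | empty => simpa using convexOn_const (0 : ℝ) convex_univ
  | cons q T hq ih =>
    simp only [Finset.sum_cons]
    exact (convexOn_univ_dist (a q)).add ih

/-- The level sets of a sum of distances are null sets in dimension at least two. A level above the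
minimum is contained in the frontier of a convex sublevel set; the minimizers lie on a common line
through any of the given points, because the norm is strictly convex. -/
theorem addHaar_setOf_sum_dist_eq [FiniteDimensional ℝ E] [MeasurableSpace E] [BorelSpace E]
    (μ : Measure E) [μ.IsAddHaarMeasure] (hE : 2 ≤ Module.finrank ℝ E) {T : Finset ι}
    (hT : T.Nonempty) (a : ι → E) (c : ℝ) : μ {y | ∑ q ∈ T, dist y (a q) = c} = 0 := by
  have hconv := convexOn_sum_dist T a
  set f : E → ℝ := fun y => ∑ q ∈ T, dist y (a q) with hf
  have hfc : Continuous f := by fun_prop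
  by_cases hmin : ∃ y, f y < c
  · obtain ⟨y, hy⟩ := hmin
    refine measure_mono_null ?_ (Convex.addHaar_frontier μ (hconv.convex_le c))
    intro x hx
    have hx' : f x = c := hx
    refine ⟨subset_closure ⟨Set.mem_univ _, hx'.le⟩, fun hint => ?_⟩
    have hline : Filter.Tendsto (fun s : ℝ => x + s • (x - y)) (nhds 0) (nhds x) := by
      have : Continuous fun s : ℝ => x + s • (x - y) := by fun_prop
      simpa using this.tendsto 0
    have hev := hline.eventually (mem_interior_iff_mem_nhds.1 hint)
    obtain ⟨s, hs, hs0⟩ :=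
      ((hev.filter_mono nhdsWithin_le_nhds).and (self_mem_nhdsWithin (s := Set.Ioi (0 : ℝ)))).exists
    have hs0 : 0 < s := hs0
    have hs1 : f (x + s • (x - y)) ≤ c := hs.2
    -- `x` is the convex combination of `y` and the point beyond it with weights `s : 1`
    have h1 := hconv.2 (Set.mem_univ y) (Set.mem_univ (x + s • (x - y)))
      (show 0 ≤ s / (1 + s) by positivity) (show 0 ≤ 1 / (1 + s) by positivity)
      (by field_simp; ring)
    have h2 : (s / (1 + s)) • y + (1 / (1 + s)) • (x + s • (x - y)) = x := by
      rw [smul_add, smul_smul, smul_sub, one_div_mul_eq_div]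
      have : (1 / (1 + s)) • x + (s / (1 + s)) • x = x := by
        rw [← add_smul]
        have : 1 / (1 + s) + s / (1 + s) = 1 := by field_simp
        rw [this, one_smul]
      conv_rhs => rw [← this]
      abel
    rw [h2, hx', smul_eq_mul, smul_eq_mul] at h1
    have h3 : s / (1 + s) * f y < s / (1 + s) * c := by gcongr
    have h4 : 1 / (1 + s) * f (x + s • (x - y)) ≤ 1 / (1 + s) * c := by gcongr
    have h5 : s / (1 + s) * c + 1 / (1 + s) * c = c := by field_simp; ring
    linarith
  · push Not at hmin
    obtain ⟨q₀, hq₀⟩ := hT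
    -- all minimizers lie on a line through `a q₀`
    obtain ⟨w, hw⟩ : ∃ w : E, ∀ y, f y = c → y - a q₀ ∈ Submodule.span ℝ {w} := by
      by_cases h : ∃ p, f p = c ∧ p ≠ a q₀
      · obtain ⟨p, hp, hpa⟩ := h
        refine ⟨p - a q₀, fun y hy => ?_⟩
        have hterm : ∀ q ∈ T, 2 * dist ((1 / 2 : ℝ) • p + (1 / 2 : ℝ) • y) (a q)
            ≤ dist p (a q) + dist y (a q) := fun q _ => by
          have := (convexOn_univ_dist (a q)).2 (Set.mem_univ p) (Set.mem_univ y)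
            (show (0 : ℝ) ≤ 1 / 2 by norm_num) (show (0 : ℝ) ≤ 1 / 2 by norm_num) (by norm_num)
          simp only [smul_eq_mul] at this
          linarith
        have hsum : ∑ q ∈ T, 2 * dist ((1 / 2 : ℝ) • p + (1 / 2 : ℝ) • y) (a q)
            = ∑ q ∈ T, (dist p (a q) + dist y (a q)) := by
          refine le_antisymm (Finset.sum_le_sum hterm) ?_
          rw [← Finset.mul_sum, Finset.sum_add_distrib]
          have h1 := hmin ((1 / 2 : ℝ) • p + (1 / 2 : ℝ) • y)
          simp only [hf] at h1 hp hy
          linarith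
        have h0 := (Finset.sum_eq_sum_iff_of_le hterm).1 hsum q₀ hq₀
        have h1 : ‖(p - a q₀) + (y - a q₀)‖ = ‖p - a q₀‖ + ‖y - a q₀‖ := by
          rw [← dist_eq_norm p, ← dist_eq_norm y, ← h0, dist_eq_norm]
          have h2 : (p - a q₀) + (y - a q₀)
              = (2 : ℝ) • ((1 / 2 : ℝ) • p + (1 / 2 : ℝ) • y - a q₀) := by
            rw [smul_sub, smul_add, smul_smul, smul_smul, two_smul]
            norm_num
            abel
          rw [h2, norm_smul]
          norm_num
        obtain ⟨r, _, hr⟩ := (sameRay_iff_norm_add.2 h1).exists_nonneg_left (sub_ne_zero.2 hpa)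
        exact Submodule.mem_span_singleton.2 ⟨r, hr⟩
      · push Not at h
        exact ⟨0, fun y hy => by rw [h y hy, sub_self]; exact Submodule.zero_mem _⟩
    have hne : Submodule.span ℝ {w} ≠ ⊤ := fun h => by
      have h1 := finrank_span_le_card (R := ℝ) ({w} : Set E)
      rw [Set.toFinset_singleton, Finset.card_singleton, h, finrank_top] at h1
      omega
    refine measure_mono_null (t := (fun y => y - a q₀) ⁻¹' (Submodule.span ℝ {w} : Set E))
      (fun y hy => hw y hy) ?_
    simp only [sub_eq_add_neg, measure_preimage_add_right]
    exact Measure.addHaar_submodule μ _ hne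

/-- A measurable set in a product space is null if all its sections in one direction are null. -/
theorem pi_eq_zero_of_forall_update [Fintype ι] [DecidableEq ι] {X : ι → Type*}
    [∀ i, MeasurableSpace (X i)] (μ : ∀ i, Measure (X i)) [∀ i, SigmaFinite (μ i)]
    {S : Set (∀ i, X i)} (hS : MeasurableSet S) (i : ι)
    (h : ∀ x, μ i {y | Function.update x i y ∈ S} = 0) : Measure.pi μ S = 0 := by
  by_cases hne : Nonempty (∀ i, X i)
  · obtain ⟨x⟩ := hne
    rw [← lintegral_indicator_one hS, lintegral_eq_lmarginal_univ x,
      lmarginal_erase' _ (measurable_one.indicator hS) (Finset.mem_univ i)]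
    have : (fun x : ∀ i, X i => ∫⁻ y, S.indicator (1 : (∀ i, X i) → ENNReal)
        (Function.update x i y) ∂μ i) = fun _ => 0 := by
      funext x
      have hm : MeasurableSet {y | Function.update x i y ∈ S} :=
        (measurable_update x) hS
      rw [← h x, ← lintegral_indicator_one hm]
      rfl
    rw [this]
    simp [lmarginal]
  · rw [not_nonempty_iff] at hne
    rw [Set.eq_empty_of_isEmpty S, measure_empty]

end Ties

section Sample

variable {k m : ℕ} {ν : Fin k → ℕ}

/-- The cost of the `ℓ`-th point of ball `i` as a center for the points drawn from ball `i`. -/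
noncomputable def clusterCost (x : Sample m ν) (i : Fin k) (ℓ : Fin (ν i)) : ℝ :=
  ∑ ℓ' : Fin (ν i), dist (x ⟨i, ℓ⟩) (x ⟨i, ℓ'⟩)

theorem continuous_clusterCost (i : Fin k) (ℓ : Fin (ν i)) :
    Continuous fun x : Sample m ν => clusterCost x i ℓ := by
  unfold clusterCost; fun_prop

theorem ESBM.ae_mem_closedBall (M : ESBM k m) (i : Fin k) :
    ∀ᵐ x ∂M.μ i, x ∈ Metric.closedBall (M.center i) (M.radius i) :=
  M.μ_compl_ball i

theorem ESBM.NullOfLebesgueNull.measure_eq_zero {M : ESBM k m} (h : M.NullOfLebesgueNull)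
    (i : Fin k) {s : Set (EuclideanSpace ℝ (Fin m))} (hs : volume s = 0) : M.μ i s = 0 := by
  have h1 := h i (s ∩ Metric.closedBall (M.center i) (M.radius i)) Set.inter_subset_right
    (measure_mono_null Set.inter_subset_left hs)
  rw [← Set.inter_union_compl s (Metric.closedBall (M.center i) (M.radius i))]
  exact measure_union_null h1 (measure_mono_null Set.inter_subset_right (M.μ_compl_ball i))

/-- Two points of a cluster of at least three almost surely have different costs: given all the
other points, a tie confines one of the two to a level set of a sum of distances. -/
theorem ESBM.law_clusterCost_eq (M : ESBM k m) (hm : 2 ≤ m) (h : M.NullOfLebesgueNull)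
    (i : Fin k) (hν : 3 ≤ ν i) {ℓ ℓ' : Fin (ν i)} (hne : ℓ ≠ ℓ') :
    M.law ν {x | clusterCost x i ℓ = clusterCost x i ℓ'} = 0 := by
  classical
  refine pi_eq_zero_of_forall_update _ (measurableSet_eq_fun
    (continuous_clusterCost i ℓ).measurable (continuous_clusterCost i ℓ').measurable) ⟨i, ℓ⟩
    fun x => h.measure_eq_zero i ?_
  -- the distance between the two points occurs in both costs and cancels
  set T : Finset (Fin (ν i)) := (Finset.univ.erase ℓ).erase ℓ' with hT
  have hcard : T.Nonempty := by
    rw [← Finset.card_pos, hT, Finset.card_erase_of_mem (by simp [hne.symm]),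
      Finset.card_erase_of_mem (Finset.mem_univ _), Finset.card_univ, Fintype.card_fin]
    omega
  have hsplit : ∀ g : Fin (ν i) → ℝ, ∑ l, g l = g ℓ + (g ℓ' + ∑ l ∈ T, g l) := fun g => by
    rw [hT, Finset.add_sum_erase _ _ (by simp [hne.symm]), Finset.add_sum_erase _ _ (by simp)]
  have hup : ∀ l, l ≠ ℓ → ∀ y, Function.update x ⟨i, ℓ⟩ y ⟨i, l⟩ = x ⟨i, l⟩ := fun l hl y =>
    Function.update_of_ne (fun e => hl (by simpa using e)) _ _
  refine measure_mono_null ?_ (addHaar_setOf_sum_dist_eq volume (by simpa using hm) hcard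
    (fun l => x ⟨i, l⟩) (∑ l ∈ T, dist (x ⟨i, ℓ'⟩) (x ⟨i, l⟩)))
  intro y hy
  have hTl : ∀ l ∈ T, l ≠ ℓ := fun l hl => by
    rw [hT, Finset.mem_erase, Finset.mem_erase] at hl; exact hl.2.1
  have hy' : clusterCost (Function.update x ⟨i, ℓ⟩ y) i ℓ
      = clusterCost (Function.update x ⟨i, ℓ⟩ y) i ℓ' := hy
  unfold clusterCost at hy'
  rw [hsplit, hsplit] at hy'
  simp only [Function.update_self, hup ℓ' hne.symm, dist_self, dist_comm _ y] at hy'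
  rw [Finset.sum_congr rfl fun l hl => by rw [hup l (hTl l hl)],
    Finset.sum_congr (s₁ := T) (s₂ := T)
      (f := fun l => dist (x ⟨i, ℓ'⟩) (Function.update x ⟨i, ℓ⟩ y ⟨i, l⟩)) rfl
      fun l hl => by rw [hup l (hTl l hl)]] at hy'
  show ∑ l ∈ T, dist y (x ⟨i, l⟩) = _
  linarith

end Sample

end KMedian

namespace KMedian

/-! ### Concentration of the contributions -/

section LargeNumbers

variable {k m : ℕ} {ν : Fin k → ℕ}

instance (M : ESBM k m) (ν : Fin k → ℕ) : IsProbabilityMeasure (M.law ν) := by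
  unfold ESBM.law; infer_instance

/-- Chebyshev's inequality for the sum of a bounded function over the points of one ball. -/
theorem ESBM.law_real_deviation_le (M : ESBM k m) (ν : Fin k → ℕ) (j : Fin k) (hν : 0 < ν j)
    {f : EuclideanSpace ℝ (Fin m) → ℝ} (hf : Measurable f) {B : ℝ}
    (hB : ∀ q, f q ∈ Set.Icc 0 B) {δ : ℝ} (hδ : 0 < δ) :
    (M.law ν).real {x | δ * ν j ≤ |∑ ℓ, f (x ⟨j, ℓ⟩) - ν j * ∫ q, f q ∂M.μ j|}
      ≤ B ^ 2 / (ν j * δ ^ 2) := by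
  classical
  -- the sum over ball `j` as a sum over all points, with zero terms for those of the other balls
  set X : PointIndex ν → EuclideanSpace ℝ (Fin m) → ℝ := fun p => if p.1 = j then f else 0 with hX
  have hXm : ∀ p, Measurable (X p) := fun p => by
    simp only [hX]; split_ifs
    · exact hf
    · exact measurable_zero
  have hB0 : 0 ≤ B := (hB 0).1.trans (hB 0).2
  have hXb : ∀ p q, X p q ∈ Set.Icc 0 B := fun p q => by
    simp only [hX]; split_ifs
    · exact hB q
    · exact ⟨le_rfl, hB0⟩
  have hL2 : ∀ p, MemLp (X p) 2 (M.μ p.1) := fun p =>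
    MemLp.of_bound (hXm p).aestronglyMeasurable B (Filter.Eventually.of_forall fun q => by
      rw [Real.norm_eq_abs, abs_of_nonneg (hXb p q).1]; exact (hXb p q).2)
  have hsumj : ∀ g : ∀ p : PointIndex ν, ℝ, (∀ p, p.1 ≠ j → g p = 0) →
      ∑ p, g p = ∑ ℓ, g ⟨j, ℓ⟩ := fun g hg => by
    rw [Fintype.sum_sigma, Finset.sum_eq_single j]
    · intro i _ hi
      exact Finset.sum_eq_zero fun ℓ _ => hg _ hi
    · simp
  have hsum : ∀ x : Sample m ν, (∑ p, fun x : Sample m ν => X p (x p)) x = ∑ ℓ, f (x ⟨j, ℓ⟩) :=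
    fun x => by
      rw [Finset.sum_apply, hsumj]
      · simp [hX]
      · intro p hp; simp [hX, hp]
  have hL2' : ∀ p, MemLp (fun x : Sample m ν => X p (x p)) 2 (M.law ν) := fun p =>
    MemLp.of_bound ((hXm p).comp (measurable_pi_apply p)).aestronglyMeasurable B
      (Filter.Eventually.of_forall fun x => by
        rw [Real.norm_eq_abs, abs_of_nonneg (hXb p _).1]; exact (hXb p _).2)
  have hmean : ∫ x, (∑ p, fun x : Sample m ν => X p (x p)) x ∂M.law ν
      = ν j * ∫ q, f q ∂M.μ j := by
    simp only [Finset.sum_apply]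
    rw [integral_finsetSum _ fun p _ => (hL2' p).integrable (by norm_num)]
    have : ∀ p, ∫ x, X p (x p) ∂M.law ν = ∫ q, X p q ∂M.μ p.1 := fun p =>
      integral_comp_eval (μ := fun p : PointIndex ν => M.μ p.1) (hXm p).aestronglyMeasurable
    simp only [this]
    rw [hsumj]
    · simp [hX]
    · intro p hp; simp [hX, hp]
  have hvar : ProbabilityTheory.variance (∑ p, fun x : Sample m ν => X p (x p)) (M.law ν)
      ≤ ν j * B ^ 2 := by
    have h1 := ProbabilityTheory.variance_sum_pi (μ := fun p : PointIndex ν => M.μ p.1) hL2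
    have h2 : ∑ p, ProbabilityTheory.variance (X p) (M.μ p.1)
        = ∑ ℓ : Fin (ν j), ProbabilityTheory.variance f (M.μ j) := by
      rw [hsumj]
      · simp [hX]
      · intro p hp
        simp [hX, hp, ProbabilityTheory.variance_zero]
    rw [ESBM.law, h1, h2, Finset.sum_const, Finset.card_univ, Fintype.card_fin, nsmul_eq_mul]
    have h3 := ProbabilityTheory.variance_le_sq_of_bounded (μ := M.μ j)
      (Filter.Eventually.of_forall hB) hf.aemeasurable
    have h4 : ((B - 0) / 2) ^ 2 ≤ B ^ 2 := by nlinarith [sq_nonneg B]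
    exact mul_le_mul_of_nonneg_left (h3.trans h4) (Nat.cast_nonneg _)
  have hνj : (0 : ℝ) < ν j := by exact_mod_cast hν
  have hcheb := ProbabilityTheory.meas_ge_le_variance_div_sq
    (memLp_finsetSum' Finset.univ fun p _ => hL2' p) (mul_pos hδ hνj)
  rw [hmean] at hcheb
  simp only [hsum] at hcheb
  rw [measureReal_def]
  refine ENNReal.toReal_le_of_le_ofReal (by positivity) (hcheb.trans (ENNReal.ofReal_le_ofReal ?_))
  rw [div_le_div_iff₀ (by positivity) (by positivity)]
  calc _ ≤ (ν j * B ^ 2) * (ν j * δ ^ 2) := by gcongr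
    _ = _ := by ring

/-- The contribution `(α - dist p q)₊` of the point `q` to the dual constraint of `p`. -/
noncomputable def contribution {X : Type*} [Dist X] (α : ℝ) (p q : X) : ℝ := max (α - dist p q) 0

section

variable {X : Type*} [PseudoMetricSpace X] {α α' : ℝ} {p p' q : X}

theorem contribution_nonneg : 0 ≤ contribution α p q := le_max_right _ _

theorem sub_le_contribution : α - dist p q ≤ contribution α p q := le_max_left _ _

theorem contribution_of_le (h : dist p q ≤ α) : contribution α p q = α - dist p q :=
  max_eq_left (by linarith)

theorem contribution_of_ge (h : α ≤ dist p q) : contribution α p q = 0 :=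
  max_eq_right (by linarith)

theorem contribution_le_abs : contribution α p q ≤ |α| :=
  max_le (by linarith [le_abs_self α, dist_nonneg (x := p) (y := q)]) (abs_nonneg _)

theorem contribution_le_add : contribution α p q ≤ contribution α p' q + dist p p' := by
  refine max_le ?_ (add_nonneg contribution_nonneg dist_nonneg)
  have := dist_triangle p' p q
  rw [dist_comm p' p] at this
  linarith [sub_le_contribution (α := α) (p := p') (q := q)]

theorem contribution_le_add_of_le {c : ℝ} (hc : 0 ≤ c) (h : α' ≤ α + c) :
    contribution α' p q ≤ contribution α p q + c :=
  max_le (by linarith [sub_le_contribution (α := α) (p := p) (q := q)])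
    (add_nonneg contribution_nonneg hc)

theorem continuous_contribution (α : ℝ) (p : X) : Continuous (contribution α p) := by
  unfold contribution; fun_prop

end

theorem integrable_contribution (M : ESBM k m) (j : Fin k) (α : ℝ)
    (p : EuclideanSpace ℝ (Fin m)) : Integrable (contribution α p) (M.μ j) :=
  Integrable.of_bound (C := |α|) (continuous_contribution α p).aestronglyMeasurable
    (Filter.Eventually.of_forall fun q => by
      rw [Real.norm_eq_abs, abs_of_nonneg contribution_nonneg]; exact contribution_le_abs)

/-- The event that, for all the triples `(j, p, α)` in `tests`, the total contribution of the points
of ball `j` to `p` deviates from its mean by less than `δ` per point. -/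
def ESBM.concentrated (M : ESBM k m) (ν : Fin k → ℕ)
    (tests : Finset (Fin k × EuclideanSpace ℝ (Fin m) × ℝ)) (δ : ℝ) : Set (Sample m ν) :=
  {x | ∀ t ∈ tests, |∑ ℓ, contribution t.2.2 t.2.1 (x ⟨t.1, ℓ⟩)
    - ν t.1 * ∫ q, contribution t.2.2 t.2.1 q ∂M.μ t.1| < δ * ν t.1}

theorem ESBM.measurableSet_concentrated (M : ESBM k m) (ν : Fin k → ℕ)
    (tests : Finset (Fin k × EuclideanSpace ℝ (Fin m) × ℝ)) (δ : ℝ) :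
    MeasurableSet (M.concentrated ν tests δ) := by
  have : M.concentrated ν tests δ = ⋂ t ∈ tests, {x | |∑ ℓ, contribution t.2.2 t.2.1 (x ⟨t.1, ℓ⟩)
      - ν t.1 * ∫ q, contribution t.2.2 t.2.1 q ∂M.μ t.1| < δ * ν t.1} := by
    ext x; simp [concentrated]
  rw [this]
  refine Finset.measurableSet_biInter _ fun t _ => measurableSet_lt ?_ measurable_const
  have : Continuous fun x : Sample m ν => |∑ ℓ, contribution t.2.2 t.2.1 (x ⟨t.1, ℓ⟩)
      - ν t.1 * ∫ q, contribution t.2.2 t.2.1 q ∂M.μ t.1| := by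
    have h := continuous_contribution t.2.2 t.2.1
    fun_prop
  exact this.measurable

theorem ESBM.exists_law_real_compl_concentrated_le (M : ESBM k m)
    (tests : Finset (Fin k × EuclideanSpace ℝ (Fin m) × ℝ)) {δ : ℝ} (hδ : 0 < δ) :
    ∃ K : ℝ, ∀ n : ℕ, 0 < n → ∀ ν : Fin k → ℕ, (∀ i, n ≤ ν i) →
      (M.law ν).real (M.concentrated ν tests δ)ᶜ ≤ K / n := by
  refine ⟨∑ t ∈ tests, |t.2.2| ^ 2 / δ ^ 2, fun n hn ν hν => ?_⟩
  have hn' : (0 : ℝ) < n := by exact_mod_cast hn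
  have hsub : (M.concentrated ν tests δ)ᶜ ⊆ ⋃ t ∈ tests,
      {x | δ * ν t.1 ≤ |∑ ℓ, contribution t.2.2 t.2.1 (x ⟨t.1, ℓ⟩)
        - ν t.1 * ∫ q, contribution t.2.2 t.2.1 q ∂M.μ t.1|} := fun x hx => by
    simpa [concentrated] using hx
  refine (measureReal_mono hsub (measure_ne_top _ _)).trans
    ((measureReal_biUnion_finset_le _ _).trans ?_)
  rw [Finset.sum_div]
  refine Finset.sum_le_sum fun t _ => ?_
  have hνt : (n : ℝ) ≤ ν t.1 := by exact_mod_cast hν t.1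
  refine (M.law_real_deviation_le ν t.1 (hn.trans_le (hν _))
    (continuous_contribution t.2.2 t.2.1).measurable
    (fun q => ⟨contribution_nonneg, contribution_le_abs⟩) hδ).trans ?_
  rw [div_div, mul_comm (δ ^ 2)]
  gcongr

end LargeNumbers

end KMedian

namespace KMedian

/-! ### Samples with concentrated contributions -/

section Deterministic

variable {k m : ℕ} {ν : Fin k → ℕ}

/-- The certificate for one sample. Here `ρ j` and `F j p` stand for the mean distance of a point
of ball `j` to its center and for its mean contribution to `p`. The multiplier of all the points
drawn from ball `j` is close to `ρ j + W / β j` and normalized so that the best center of the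
cluster satisfies its dual constraint with equality. A sampled point at distance less than `t` from
the center of its ball is compared with the best center exactly, since all the contributions of its
own cluster are untruncated and those of the others vanish; for a sampled point further away,
concentration leaves enough room. -/
theorem exactRecovery_of_deviation_le (M : ESBM k m) {n : ℕ} (hn : 0 < n)
    (hν : ∀ i, (ν i : ℝ) = M.β i * n) {W R κ t η : ℝ} {ρ : Fin k → ℝ}
    {F : Fin k → EuclideanSpace ℝ (Fin m) → ℝ} (x : Sample m ν)
    (hκ : 0 < κ) (ht : 0 < t) (hη : 0 < η) (hηκ : 3 * η < κ * t ^ 2)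
    (hηβ : 3 * η * ∑ i, M.β i < κ * t ^ 2) (hρ : ∀ i, t + 2 * η < ρ i)
    (hR : ∀ i, M.radius i ≤ R) (hWR : ∀ i, R ≤ W / M.β i)
    (hsep : ∀ i j, i ≠ j →
      ρ j + W / M.β j + M.radius j + (t + 2 * η) < dist (M.center i) (M.center j))
    (hFcenter : ∀ i, W / M.β i ≤ F i (M.center i))
    (hFown : ∀ i p, dist p (M.center i) ≤ M.radius i →
      F i p ≤ W / M.β i - κ * dist p (M.center i) ^ 2)
    (hFtotal : ∀ i p, dist p (M.center i) ≤ M.radius i →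
      ∑ j, M.β j * F j p ≤ W - κ * dist p (M.center i) ^ 2)
    (hball : ∀ p, dist (x p) (M.center p.1) ≤ M.radius p.1)
    (hdev : ∀ i j p, dist p (M.center i) ≤ M.radius i →
      |∑ ℓ, contribution (ρ j + W / M.β j) p (x ⟨j, ℓ⟩) - ν j * F j p| ≤ η * ν j)
    (hnear : ∀ i, ∃ ℓ, dist (M.center i) (x ⟨i, ℓ⟩) ≤ η)
    (hties : ∀ i ℓ ℓ', ℓ ≠ ℓ' → clusterCost x i ℓ ≠ clusterCost x i ℓ') :
    ExactRecovery x := by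
  have hn' : (0 : ℝ) < n := by exact_mod_cast hn
  have hβ0 : ∀ i, 0 < M.β i := fun i => zero_lt_one.trans_le (M.one_le_β i)
  have hν0 : ∀ i, (0 : ℝ) < ν i := fun i => by rw [hν]; exact mul_pos (hβ0 i) hn'
  have hνW : ∀ i, ν i * (W / M.β i) = n * W := fun i => by
    have := (hβ0 i).ne'
    rw [hν]; field_simp
  have hconst : ∀ (i : Fin k) (c : ℝ), ∑ _ℓ : Fin (ν i), c = ν i * c := fun i c => by simp
  have hmin : ∀ i, ∃ ℓ, ∀ ℓ', clusterCost x i ℓ ≤ clusterCost x i ℓ' := fun i => by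
    have : Nonempty (Fin (ν i)) := ⟨(hnear i).choose⟩
    exact Finite.exists_min _
  choose b hb using hmin
  -- the cost of the best center is about `ν i * ρ i`
  have hcenter : ∀ i, ∑ ℓ, dist (M.center i) (x ⟨i, ℓ⟩) ≤ ν i * (ρ i + η) := fun i => by
    have h0 : dist (M.center i) (M.center i) ≤ M.radius i := by
      rw [dist_self]; exact (M.radius_pos i).le
    have h1 := (abs_le.1 (hdev i i _ h0)).1
    have h2 : ∑ ℓ, contribution (ρ i + W / M.β i) (M.center i) (x ⟨i, ℓ⟩)
        = ν i * (ρ i + W / M.β i) - ∑ ℓ, dist (M.center i) (x ⟨i, ℓ⟩) := by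
      rw [← hconst, ← Finset.sum_sub_distrib]
      refine Finset.sum_congr rfl fun ℓ _ => contribution_of_le ?_
      have h3 := hball ⟨i, ℓ⟩
      rw [dist_comm] at h3
      linarith [hR i, hWR i, hρ i]
    have h4 := mul_le_mul_of_nonneg_left (hFcenter i) (hν0 i).le
    nlinarith
  have hbest : ∀ i, clusterCost x i (b i) ≤ ν i * (ρ i + 2 * η) := fun i => by
    obtain ⟨ℓ, hℓ⟩ := hnear i
    refine (hb i ℓ).trans ?_
    have h1 : clusterCost x i ℓ ≤ ∑ ℓ', (η + dist (M.center i) (x ⟨i, ℓ'⟩)) := by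
      refine Finset.sum_le_sum fun ℓ' _ => ?_
      have := dist_triangle (x ⟨i, ℓ⟩) (M.center i) (x ⟨i, ℓ'⟩)
      rw [dist_comm (x ⟨i, ℓ⟩) (M.center i)] at this
      linarith
    rw [Finset.sum_add_distrib, hconst] at h1
    linarith [hcenter i]
  have hcost : ∀ i ℓ, ν i * (ρ i + κ * dist (x ⟨i, ℓ⟩) (M.center i) ^ 2 - η)
      ≤ clusterCost x i ℓ := fun i ℓ => by
    have h1 := (abs_le.1 (hdev i i _ (hball ⟨i, ℓ⟩))).2
    have h2 : ν i * (ρ i + W / M.β i) - clusterCost x i ℓ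
        ≤ ∑ ℓ', contribution (ρ i + W / M.β i) (x ⟨i, ℓ⟩) (x ⟨i, ℓ'⟩) := by
      rw [← hconst, clusterCost, ← Finset.sum_sub_distrib]
      exact Finset.sum_le_sum fun ℓ' _ => sub_le_contribution
    have h4 := mul_le_mul_of_nonneg_left (hFown i _ (hball ⟨i, ℓ⟩)) (hν0 i).le
    nlinarith
  have hbnear : ∀ i, dist (x ⟨i, b i⟩) (M.center i) < t := fun i => by
    have h1 := (hcost i (b i)).trans (hbest i)
    have h2 := le_of_mul_le_mul_left h1 (hν0 i)
    by_contra! h3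
    have : κ * t ^ 2 ≤ κ * dist (x ⟨i, b i⟩) (M.center i) ^ 2 := by gcongr
    linarith
  set A : Fin k → ℝ := fun i => W / M.β i + clusterCost x i (b i) / ν i with hA
  have hνA : ∀ i, ν i * A i = n * W + clusterCost x i (b i) := fun i => by
    have := (hν0 i).ne'
    simp only [hA]
    rw [mul_add, hνW]; field_simp
  have hAle : ∀ i, A i ≤ ρ i + W / M.β i + 2 * η := fun i => by
    have : clusterCost x i (b i) / ν i ≤ ρ i + 2 * η := by
      rw [div_le_iff₀' (hν0 i)]; exact hbest i
    simp only [hA]; linarith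
  have hAge : ∀ i, ρ i + W / M.β i - η ≤ A i := fun i => by
    have : ρ i - η ≤ clusterCost x i (b i) / ν i := by
      rw [le_div_iff₀' (hν0 i)]
      refine le_trans ?_ (hcost i (b i))
      have : 0 ≤ κ * dist (x ⟨i, b i⟩) (M.center i) ^ 2 := by positivity
      exact mul_le_mul_of_nonneg_left (by linarith) (hν0 i).le
    simp only [hA]; linarith
  -- for sampled points near the center, nothing is truncated in the own cluster, and the others
  -- are out of reach
  have hin : ∀ i ℓ, dist (x ⟨i, ℓ⟩) (M.center i) < t → ∀ ℓ', dist (x ⟨i, ℓ⟩) (x ⟨i, ℓ'⟩) ≤ A i := by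
    intro i ℓ hℓ ℓ'
    have h1 := dist_triangle_right (x ⟨i, ℓ⟩) (x ⟨i, ℓ'⟩) (M.center i)
    have h2 := hball ⟨i, ℓ'⟩
    dsimp only at h2
    linarith [hAge i, hR i, hWR i, hρ i]
  have hout : ∀ i ℓ, dist (x ⟨i, ℓ⟩) (M.center i) < t → ∀ j, i ≠ j → ∀ ℓ',
      A j < dist (x ⟨i, ℓ⟩) (x ⟨j, ℓ'⟩) := by
    intro i ℓ hℓ j hij ℓ'
    have h1 := dist_triangle4 (M.center i) (x ⟨i, ℓ⟩) (x ⟨j, ℓ'⟩) (M.center j)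
    rw [dist_comm (M.center i) (x ⟨i, ℓ⟩)] at h1
    have h2 := hball ⟨j, ℓ'⟩
    dsimp only at h2
    linarith [hAle j, hsep i j hij]
  have hnearsum : ∀ i ℓ, dist (x ⟨i, ℓ⟩) (M.center i) < t →
      ∑ q : PointIndex ν, contribution (A q.1) (x ⟨i, ℓ⟩) (x q)
        = n * W + clusterCost x i (b i) - clusterCost x i ℓ := fun i ℓ hℓ => by
    rw [Fintype.sum_sigma, Finset.sum_eq_single i]
    · rw [← hνA, ← hconst, clusterCost, ← Finset.sum_sub_distrib]
      exact Finset.sum_congr rfl fun ℓ' _ => contribution_of_le (hin i ℓ hℓ ℓ')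
    · intro j _ hj
      exact Finset.sum_eq_zero fun ℓ' _ => contribution_of_ge (hout i ℓ hℓ j hj.symm ℓ').le
    · simp
  have hfarsum : ∀ i ℓ, t ≤ dist (x ⟨i, ℓ⟩) (M.center i) →
      ∑ q : PointIndex ν, contribution (A q.1) (x ⟨i, ℓ⟩) (x q) < n * W := fun i ℓ hℓ => by
    have hp := hball ⟨i, ℓ⟩
    have h1 : ∀ j, ∑ ℓ', contribution (A j) (x ⟨i, ℓ⟩) (x ⟨j, ℓ'⟩)
        ≤ n * (M.β j * F j (x ⟨i, ℓ⟩)) + n * (3 * η * M.β j) := fun j => by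
      have h2 : ∑ ℓ', contribution (A j) (x ⟨i, ℓ⟩) (x ⟨j, ℓ'⟩)
          ≤ ∑ ℓ', (contribution (ρ j + W / M.β j) (x ⟨i, ℓ⟩) (x ⟨j, ℓ'⟩) + 2 * η) :=
        Finset.sum_le_sum fun ℓ' _ => contribution_le_add_of_le (by linarith) (hAle j)
      rw [Finset.sum_add_distrib, hconst] at h2
      have h3 := (abs_le.1 (hdev i j _ hp)).2
      have h4 := hν j
      rw [h4] at h2 h3
      linarith
    rw [Fintype.sum_sigma]
    refine (Finset.sum_le_sum fun j _ => h1 j).trans_lt ?_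
    rw [Finset.sum_add_distrib, ← Finset.mul_sum, ← Finset.mul_sum, ← mul_add, ← Finset.mul_sum]
    refine mul_lt_mul_of_pos_left ?_ hn'
    have h5 : κ * t ^ 2 ≤ κ * dist (x ⟨i, ℓ⟩) (M.center i) ^ 2 := by gcongr
    have h6 := hFtotal i _ hp
    linarith
  obtain ⟨y, z, h1, h2, h3, h4⟩ := exists_unique_optimal_of_certificate x (fun q => q.1)
    (fun i => ⟨i, b i⟩) (fun _ => rfl) (fun q => A q.1) (n * W)
    (fun i => by
      have := hnearsum i (b i) (hbnear i)
      rw [add_sub_cancel_right] at this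
      exact this)
    (fun ⟨i, ℓ⟩ hp => by
      by_cases hd : dist (x ⟨i, ℓ⟩) (M.center i) < t
      · have h1 : clusterCost x i (b i) < clusterCost x i ℓ :=
          lt_of_le_of_ne (hb i ℓ) (hties i _ _ fun h => hp i (by rw [h]))
        have h2 := hnearsum i ℓ hd
        have h3 : ∑ q : PointIndex ν, contribution (A q.1) (x ⟨i, ℓ⟩) (x q) < n * W := by
          rw [h2]; linarith
        exact h3
      · exact hfarsum i ℓ (not_lt.1 hd))
    (fun ⟨i, ℓ⟩ => hin i (b i) (hbnear i) ℓ)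
    (fun i ⟨j, ℓ⟩ hij => hout i (b i) (hbnear i) j (Ne.symm hij) ℓ)
  exact ⟨y, z, h1, h2, h3, fun i => ⟨i, b i⟩, fun _ => rfl, h4⟩

end Deterministic

end KMedian

namespace KMedian

/-! ### Mean contributions in the extended stochastic ball model -/

section Model

variable {k m : ℕ}

theorem ESBM.isRotationInvariant_map_sub (M : ESBM k m) (h : M.RotationInvariant) (i : Fin k) :
    IsRotationInvariant ((M.μ i).map fun q => q - M.center i) := fun g hg => by
  have hsub : Measurable fun q => q - M.center i := by fun_prop
  have hg' : Measurable g := g.continuous.measurable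
  rw [Measure.map_map hg' hsub]
  conv_rhs => rw [← h i g hg]
  rw [Measure.map_map hsub (by fun_prop)]
  congr 1
  funext q
  simp

theorem ESBM.ae_map_sub_norm_le (M : ESBM k m) (i : Fin k) :
    ∀ᵐ x ∂(M.μ i).map fun q => q - M.center i, ‖x‖ ≤ M.radius i := by
  rw [ae_map_iff (by fun_prop) (measurableSet_le measurable_norm measurable_const)]
  filter_upwards [M.ae_mem_closedBall i] with q hq
  rwa [← dist_eq_norm]

theorem ESBM.integral_map_sub (M : ESBM k m) (i : Fin k) {f : EuclideanSpace ℝ (Fin m) → ℝ}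
    (hf : Continuous f) :
    ∫ x, f x ∂(M.μ i).map (fun q => q - M.center i) = ∫ q, f (q - M.center i) ∂M.μ i :=
  integral_map (by fun_prop) hf.aestronglyMeasurable

theorem ESBM.integral_contribution (M : ESBM k m) (i : Fin k) (α : ℝ)
    (p : EuclideanSpace ℝ (Fin m)) :
    ∫ q, contribution α p q ∂M.μ i
      = ∫ x, max (α - ‖(p - M.center i) - x‖) 0 ∂(M.μ i).map (fun q => q - M.center i) := by
  rw [M.integral_map_sub i (by fun_prop)]
  simp only [contribution, dist_eq_norm, sub_sub_sub_cancel_right]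

instance (M : ESBM k m) (i : Fin k) :
    IsProbabilityMeasure ((M.μ i).map fun q => q - M.center i) :=
  Measure.isProbabilityMeasure_map (by fun_prop)

/-- The mean distance of a random point of ball `i` to its center. -/
noncomputable def ESBM.meanDist (M : ESBM k m) (i : Fin k) : ℝ := ∫ q, dist q (M.center i) ∂M.μ i

theorem ESBM.meanDist_eq (M : ESBM k m) (i : Fin k) :
    M.meanDist i = ∫ x, ‖x‖ ∂(M.μ i).map (fun q => q - M.center i) := by
  rw [M.integral_map_sub i continuous_norm]
  simp only [meanDist, dist_eq_norm]

theorem ESBM.integrable_dist (M : ESBM k m) (i : Fin k) :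
    Integrable (fun q => dist q (M.center i)) (M.μ i) := by
  refine Integrable.of_bound (C := M.radius i) (by fun_prop) ?_
  filter_upwards [M.ae_mem_closedBall i] with q hq
  rw [Real.norm_eq_abs, abs_of_nonneg dist_nonneg]
  exact hq

theorem ESBM.meanDist_le (M : ESBM k m) (i : Fin k) : M.meanDist i ≤ M.radius i := by
  have : ∫ q, dist q (M.center i) ∂M.μ i ≤ ∫ _, M.radius i ∂M.μ i :=
    integral_mono_ae (M.integrable_dist i) (integrable_const _) (M.ae_mem_closedBall i)
  simpa [meanDist] using this

theorem ESBM.meanDist_pos (M : ESBM k m) (hm : 2 ≤ m) (h : M.NullOfLebesgueNull) (i : Fin k) :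
    0 < M.meanDist i := by
  have : Nonempty (Fin m) := ⟨⟨0, by omega⟩⟩
  rw [meanDist, integral_pos_iff_support_of_nonneg (fun _ => dist_nonneg) (M.integrable_dist i)]
  have h1 : (Function.support fun q => dist q (M.center i)) = {M.center i}ᶜ := by
    ext q; simp
  have h2 : M.μ i {M.center i} = 0 := h.measure_eq_zero i (measure_singleton _)
  rw [h1, (prob_compl_eq_one_iff (measurableSet_singleton _)).2 h2]
  exact one_pos

theorem ESBM.integral_contribution_pos (M : ESBM k m) (h : M.PosNearCenter) (i : Fin k) {η : ℝ}
    (hη : 0 < η) : 0 < ∫ q, contribution η (M.center i) q ∂M.μ i := by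
  rw [integral_pos_iff_support_of_nonneg (fun _ => contribution_nonneg)
    (integrable_contribution M i _ _)]
  refine (h i _ Metric.isOpen_ball (Metric.mem_ball_self hη)).trans_le
    (measure_mono fun q hq => ?_)
  have h1 : dist q (M.center i) < η := hq.1
  rw [dist_comm] at h1
  have h2 := sub_le_contribution (α := η) (p := M.center i) (q := q)
  exact (by linarith : 0 < contribution η (M.center i) q).ne'

theorem ESBM.integral_contribution_center (M : ESBM k m) (i : Fin k) (α : ℝ) :
    α - M.meanDist i ≤ ∫ q, contribution α (M.center i) q ∂M.μ i := by
  have h1 : α - M.meanDist i = ∫ q, (α - dist q (M.center i)) ∂M.μ i := by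
    rw [integral_sub (integrable_const _) (M.integrable_dist i)]
    simp [meanDist]
  rw [h1]
  refine integral_mono ((integrable_const _).sub (M.integrable_dist i))
    (integrable_contribution M i _ _) fun q => ?_
  have := sub_le_contribution (α := α) (p := M.center i) (q := q)
  rw [dist_comm] at this
  exact this

theorem ESBM.integral_contribution_le_add_dist (M : ESBM k m) (i : Fin k) (α : ℝ)
    (p p' : EuclideanSpace ℝ (Fin m)) :
    ∫ q, contribution α p q ∂M.μ i ≤ ∫ q, contribution α p' q ∂M.μ i + dist p p' := by
  have h1 : ∫ q, contribution α p q ∂M.μ i ≤ ∫ q, (contribution α p' q + dist p p') ∂M.μ i :=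
    integral_mono (integrable_contribution M i _ _)
      ((integrable_contribution M i _ _).add (integrable_const _)) fun q => contribution_le_add
  rw [integral_add (integrable_contribution M i _ _) (integrable_const _)] at h1
  simpa using h1

theorem ESBM.integral_contribution_own_le (M : ESBM k m) (hm : 2 ≤ m) (h : M.RotationInvariant)
    (i : Fin k) {R α : ℝ} (hR : M.radius i ≤ R) (hα : M.meanDist i + R ≤ α)
    {p : EuclideanSpace ℝ (Fin m)} (hp : dist p (M.center i) ≤ M.radius i) :
    ∫ q, contribution α p q ∂M.μ i
      ≤ α - M.meanDist i - dist p (M.center i) ^ 2 / (12 * R) := by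
  rw [M.meanDist_eq] at hα ⊢
  rw [M.integral_contribution, dist_eq_norm]
  rw [dist_eq_norm] at hp
  refine (M.isRotationInvariant_map_sub h i).integral_pos_part_le (by simpa using hm)
    ((M.radius_pos i).trans_le hR) ?_ hα (hp.trans hR)
  filter_upwards [M.ae_map_sub_norm_le i] with x hx
  exact hx.trans hR

/-- The mean contribution of another ball to a point `p` of ball `i`, compared with the squared
distance from `p` to the center of its own ball. With `t` this distance, the slack in the direction
from `center j` to `p` is `σ = R - t + ε`. There is no contribution for `t ≤ ε`, and otherwise
`ε * R ≤ σ * t` turns the Chebyshev bound `R ^ 3 / (m * σ ^ 2)` into a multiple of `t ^ 2`. -/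
theorem ESBM.mul_integral_contribution_other_le (M : ESBM k m) (hm : 2 ≤ m)
    (h : M.RotationInvariant) {β R ε : ℝ} (hR : ∀ i, M.radius i ≤ R) (hβ : ∀ i, M.β i ≤ β)
    (hε : 0 < ε) (hεk : 24 * β * k * R ^ 2 ≤ m * ε ^ 2) {i j : Fin k}
    (hsep : (1 + β) * R + max (M.radius i) (M.radius j) + ε < dist (M.center i) (M.center j))
    {p : EuclideanSpace ℝ (Fin m)} (hp : dist p (M.center i) ≤ M.radius i) :
    M.β j * ∫ q, contribution (M.meanDist j + β * R / M.β j) p q ∂M.μ j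
      ≤ dist p (M.center i) ^ 2 / (24 * R) / k := by
  have hr := M.radius_pos j
  have hR0 : 0 < R := hr.trans_le (hR j)
  have hβ1 := M.one_le_β j
  have hβ0 : 0 < β := by linarith [hβ j]
  have hk : (0 : ℝ) < k := by exact_mod_cast i.pos
  have hm0 : (0 : ℝ) < m := by exact_mod_cast (by omega : 0 < m)
  set t := dist p (M.center i) with ht
  have ht0 : 0 ≤ t := dist_nonneg
  have htR : t ≤ R := hp.trans (hR i)
  have hdiv : β * R / M.β j ≤ β * R := div_le_self (by positivity) hβ1
  have hα : M.meanDist j + β * R / M.β j ≤ M.radius j + β * R := add_le_add (M.meanDist_le j) hdiv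
  have hmean : 0 ≤ M.meanDist j := integral_nonneg fun _ => dist_nonneg
  have hα0 : 0 ≤ M.meanDist j + β * R / M.β j := by positivity
  have htri := dist_triangle_left (M.center i) (M.center j) p
  rw [← ht] at htri
  have hmax := le_max_right (M.radius i) (M.radius j)
  rw [M.integral_contribution]
  rw [dist_eq_norm p (M.center j)] at htri
  rcases le_or_gt t ε with htε | htε
  · rw [integral_pos_part_eq_zero (M.ae_map_sub_norm_le j) (by linarith [hR j]), mul_zero]
    positivity
  · have hσ : 0 < R - t + ε := by linarith
    have h1 := (M.isRotationInvariant_map_sub h j).integral_pos_part_le_of_le_norm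
      (by simpa using hm) (M.ae_map_sub_norm_le j) hr.le hα0 hσ (p := p - M.center j)
      (by linarith)
    rw [finrank_euclideanSpace, Fintype.card_fin] at h1
    have h2 : ε * R ≤ (R - t + ε) * t := by nlinarith
    have h3 : M.radius j ^ 3 / (m * (R - t + ε) ^ 2) ≤ R ^ 3 / (m * (R - t + ε) ^ 2) := by
      gcongr
      exact hR j
    have h4 : β * (R ^ 3 / (m * (R - t + ε) ^ 2)) ≤ t ^ 2 / (24 * R) / k := by
      rw [div_div, mul_div_assoc', div_le_div_iff₀ (by positivity) (by positivity)]
      calc β * R ^ 3 * (24 * R * k) = (24 * β * k * R ^ 2) * R ^ 2 := by ring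
        _ ≤ (m * ε ^ 2) * R ^ 2 := by gcongr
        _ = m * (ε * R) ^ 2 := by ring
        _ ≤ m * ((R - t + ε) * t) ^ 2 := by gcongr
        _ = _ := by ring
    refine le_trans ?_ h4
    exact mul_le_mul (hβ j) (h1.trans h3) (integral_nonneg fun _ => le_max_right _ _) hβ0.le

/-- In expectation, the dual constraint of a point `p` of ball `i` holds, with a slack that is
quadratic in the distance of `p` to the center. -/
theorem ESBM.sum_integral_contribution_le (M : ESBM k m) (hm : 2 ≤ m)
    (h : M.RotationInvariant) {β R ε : ℝ} (hR : ∀ i, M.radius i ≤ R) (hβ : ∀ i, M.β i ≤ β)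
    (hε : 0 < ε) (hεk : 24 * β * k * R ^ 2 ≤ m * ε ^ 2)
    (hsep : ∀ i j, i ≠ j →
      (1 + β) * R + max (M.radius i) (M.radius j) + ε < dist (M.center i) (M.center j))
    {i : Fin k} {p : EuclideanSpace ℝ (Fin m)} (hp : dist p (M.center i) ≤ M.radius i) :
    ∑ j, M.β j * ∫ q, contribution (M.meanDist j + β * R / M.β j) p q ∂M.μ j
      ≤ β * R - dist p (M.center i) ^ 2 / (24 * R) := by
  have hR0 : 0 < R := (M.radius_pos i).trans_le (hR i)
  have hβ1 := M.one_le_β i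
  have hk : (0 : ℝ) < k := by exact_mod_cast i.pos
  have hown := M.integral_contribution_own_le hm h i (hR i)
    (α := M.meanDist i + β * R / M.β i) (by
      gcongr
      rw [le_div_iff₀ (by linarith), mul_comm]
      gcongr
      exact hβ i) hp
  set t := dist p (M.center i)
  have h1 : M.β i * ∫ q, contribution (M.meanDist i + β * R / M.β i) p q ∂M.μ i
      ≤ β * R - t ^ 2 / (12 * R) := by
    refine (mul_le_mul_of_nonneg_left hown (by linarith)).trans ?_
    have h2 : M.β i * (β * R / M.β i) = β * R := by
      have : M.β i ≠ 0 := by linarith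
      field_simp
    have h3 : 1 * (t ^ 2 / (12 * R)) ≤ M.β i * (t ^ 2 / (12 * R)) := by gcongr
    linarith
  rw [← Finset.add_sum_erase _ _ (Finset.mem_univ i)]
  have h2 : ∑ j ∈ Finset.univ.erase i,
      M.β j * ∫ q, contribution (M.meanDist j + β * R / M.β j) p q ∂M.μ j
      ≤ t ^ 2 / (24 * R) := by
    refine (Finset.sum_le_sum fun j hj => M.mul_integral_contribution_other_le hm h hR hβ hε hεk
      (hsep i j (Finset.ne_of_mem_erase hj).symm) hp).trans ?_
    rw [Finset.sum_const, nsmul_eq_mul]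
    have h3 : ((Finset.univ.erase i).card : ℝ) ≤ k := by
      exact_mod_cast (Finset.card_le_univ _).trans (by simp)
    calc _ ≤ k * (t ^ 2 / (24 * R) / k) := by gcongr
      _ = t ^ 2 / (24 * R) := by field_simp
  have h3 : t ^ 2 / (12 * R) = 2 * (t ^ 2 / (24 * R)) := by ring
  linarith

end Model

end KMedian

namespace KMedian

/-! ### Exact recovery with high probability -/

section Probability

variable {k m : ℕ}

/-- Almost surely, the points lie in their balls and, in clusters of at least three points, have
different costs. -/
theorem ESBM.ae_law_mem_and_clusterCost_ne (M : ESBM k m) (hm : 2 ≤ m)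
    (h : M.NullOfLebesgueNull) {ν : Fin k → ℕ} (hν : ∀ i, 3 ≤ ν i) :
    ∀ᵐ x ∂M.law ν, (∀ p, dist (x p) (M.center p.1) ≤ M.radius p.1) ∧
      ∀ i ℓ ℓ', ℓ ≠ ℓ' → clusterCost x i ℓ ≠ clusterCost x i ℓ' := by
  refine Filter.Eventually.and ?_ ?_
  · rw [ae_all_iff]
    intro p
    exact (Measure.tendsto_eval_ae_ae (μ := fun p : PointIndex ν => M.μ p.1)
      (i := p)).eventually (M.ae_mem_closedBall p.1)
  · simp only [ae_all_iff]
    intro i ℓ ℓ' hne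
    have := M.law_clusterCost_eq hm h i (hν i) hne
    rw [ae_iff]
    simpa only [not_not] using this

theorem measurableSet_mem_and_clusterCost_ne (M : ESBM k m) (ν : Fin k → ℕ) :
    MeasurableSet {x : Sample m ν | (∀ p, dist (x p) (M.center p.1) ≤ M.radius p.1) ∧
      ∀ i ℓ ℓ', ℓ ≠ ℓ' → clusterCost x i ℓ ≠ clusterCost x i ℓ'} := by
  have h1 : MeasurableSet {x : Sample m ν | ∀ p, dist (x p) (M.center p.1) ≤ M.radius p.1} := by
    rw [Set.ofPred_forall]
    refine MeasurableSet.iInter fun p => measurableSet_le ?_ measurable_const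
    exact (by fun_prop : Continuous fun x : Sample m ν => dist (x p) (M.center p.1)).measurable
  have h2 : MeasurableSet {x : Sample m ν |
      ∀ i ℓ ℓ', ℓ ≠ ℓ' → clusterCost x i ℓ ≠ clusterCost x i ℓ'} := by
    simp only [Set.ofPred_forall]
    refine MeasurableSet.iInter fun i => MeasurableSet.iInter fun ℓ => MeasurableSet.iInter
      fun ℓ' => MeasurableSet.iInter fun _ => ?_
    exact (measurableSet_eq_fun (continuous_clusterCost i ℓ).measurable
      (continuous_clusterCost i ℓ').measurable).compl
  exact h1.inter h2

/-- Concentration at the points `p'` of a finite net implies concentration at all the points `p` that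
the net approximates, because contributions are `1`-Lipschitz. -/
theorem ESBM.abs_sum_contribution_sub_le (M : ESBM k m) {ν : Fin k → ℕ} (x : Sample m ν)
    {α η : ℝ} {j : Fin k} {p p' : EuclideanSpace ℝ (Fin m)} (hp : dist p p' ≤ η / 3)
    (h : |∑ ℓ, contribution α p' (x ⟨j, ℓ⟩) - ν j * ∫ q, contribution α p' q ∂M.μ j|
      ≤ η / 3 * ν j) :
    |∑ ℓ, contribution α p (x ⟨j, ℓ⟩) - ν j * ∫ q, contribution α p q ∂M.μ j| ≤ η * ν j := by
  have key : ∀ p p' : EuclideanSpace ℝ (Fin m), dist p p' ≤ η / 3 →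
      ∑ ℓ, contribution α p (x ⟨j, ℓ⟩) ≤ ∑ ℓ, contribution α p' (x ⟨j, ℓ⟩) + η / 3 * ν j ∧
      ν j * ∫ q, contribution α p q ∂M.μ j
        ≤ ν j * ∫ q, contribution α p' q ∂M.μ j + η / 3 * ν j := fun p p' hd => by
    constructor
    · have h1 : ∑ ℓ, contribution α p (x ⟨j, ℓ⟩)
          ≤ ∑ ℓ : Fin (ν j), (contribution α p' (x ⟨j, ℓ⟩) + η / 3) :=
        Finset.sum_le_sum fun ℓ _ => contribution_le_add.trans (by gcongr)
      rw [Finset.sum_add_distrib] at h1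
      simpa [mul_comm] using h1
    · have h1 := (M.integral_contribution_le_add_dist j α p p').trans
        (add_le_add_right hd (∫ q, contribution α p' q ∂M.μ j))
      have h2 := mul_le_mul_of_nonneg_left h1 (Nat.cast_nonneg (α := ℝ) (ν j))
      linarith
  obtain ⟨a1, a2⟩ := key p p' hp
  obtain ⟨b1, b2⟩ := key p' p (by rwa [dist_comm])
  rw [abs_le] at h ⊢
  constructor <;> linarith [h.1, h.2]

theorem exists_forall_pos_le {ι : Type*} [Finite ι] {f : ι → ℝ} (hf : ∀ i, 0 < f i) :
    ∃ c, 0 < c ∧ ∀ i, c ≤ f i := by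
  cases isEmpty_or_nonempty ι
  · exact ⟨1, one_pos, isEmptyElim⟩
  · obtain ⟨i, hi⟩ := Finite.exists_min f
    exact ⟨f i, hf i, hi⟩

/-- Exact recovery with high probability, when `ε` is large enough for the estimates of the mean
contributions. -/
theorem ESBM.withHighProbability_exactRecovery (M : ESBM k m) (hm : 2 ≤ m)
    (hrot : M.RotationInvariant) (hpos : M.PosNearCenter) (hnull : M.NullOfLebesgueNull)
    {β R ε : ℝ} (hR : ∀ i, M.radius i ≤ R) (hβ : ∀ i, M.β i ≤ β) (hR0 : 0 < R)
    (hε : 0 < ε) (hεk : 24 * β * k * R ^ 2 ≤ m * ε ^ 2)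
    (hsep : ∀ i j, i ≠ j →
      (1 + β) * R + max (M.radius i) (M.radius j) + ε < dist (M.center i) (M.center j)) :
    M.WithHighProbability (fun _ => {x | ExactRecovery x}) := by
  classical
  intro δ hδ
  have hβ0 : ∀ i, 0 < M.β i := fun i => zero_lt_one.trans_le (M.one_le_β i)
  -- the distance up to which the sampled points are compared with the best center exactly
  obtain ⟨c, hc0, hc⟩ := exists_forall_pos_le (M.meanDist_pos hm hnull)
  obtain ⟨t, ht0, htc, htε⟩ : ∃ t, 0 < t ∧ 2 * t ≤ c ∧ 2 * t ≤ ε :=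
    ⟨min c ε / 2, by positivity, by linarith [min_le_left c ε], by linarith [min_le_right c ε]⟩
  set κ : ℝ := 1 / (24 * R) with hκ
  have hκ0 : 0 < κ := by positivity
  have hB : 0 ≤ ∑ i, M.β i := Finset.sum_nonneg fun i _ => (hβ0 i).le
  -- the precision of the concentration, small in comparison with the slack at distance `t`
  obtain ⟨η, hη0, hηt, hηB⟩ : ∃ η, 0 < η ∧ 4 * η ≤ t ∧ 4 * (1 + ∑ i, M.β i) * η ≤ κ * t ^ 2 := by
    refine ⟨min (t / 4) (κ * t ^ 2 / (4 * (1 + ∑ i, M.β i))), by positivity, ?_, ?_⟩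
    · linarith [min_le_left (t / 4) (κ * t ^ 2 / (4 * (1 + ∑ i, M.β i)))]
    · have := min_le_right (t / 4) (κ * t ^ 2 / (4 * (1 + ∑ i, M.β i)))
      rwa [le_div_iff₀' (by positivity)] at this
  have hηκ : 3 * η < κ * t ^ 2 := by nlinarith
  have hηβ : 3 * η * ∑ i, M.β i < κ * t ^ 2 := by nlinarith
  have hcompact : IsCompact (⋃ i, Metric.closedBall (M.center i) (M.radius i)) :=
    isCompact_iUnion fun i => isCompact_closedBall _ _
  obtain ⟨T, -, hTfin, hT⟩ := hcompact.finite_cover_balls (e := η / 3) (by positivity)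
  obtain ⟨e, he0, he⟩ := exists_forall_pos_le fun i => M.integral_contribution_pos hpos i hη0
  set α : Fin k → ℝ := fun j => M.meanDist j + β * R / M.β j with hα
  -- the tests at the net control all contributions; those at the centers ensure that there are
  -- sampled points at distance less than `η` from them
  set tests : Finset (Fin k × EuclideanSpace ℝ (Fin m) × ℝ) :=
    (Finset.univ ×ˢ hTfin.toFinset).image (fun t => (t.1, t.2, α t.1))
      ∪ Finset.univ.image (fun i => (i, M.center i, η)) with htests
  have hδ' : 0 < min (η / 3) e := by positivity
  obtain ⟨K, hK⟩ := M.exists_law_real_compl_concentrated_le tests hδ'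
  obtain ⟨N, hN⟩ := exists_nat_gt (K / δ)
  refine ⟨max N 2, fun n hn ν hν => ?_⟩
  have hn2 : 2 < n := (le_max_right N 2).trans_lt hn
  have hnpos : 0 < n := by omega
  have hn0 : (0 : ℝ) < n := by exact_mod_cast hnpos
  have hnν : ∀ i, n ≤ ν i := fun i => by
    have : (n : ℝ) ≤ ν i := by rw [hν]; exact le_mul_of_one_le_left hn0.le (M.one_le_β i)
    exact_mod_cast this
  refine ⟨M.concentrated ν tests (min (η / 3) e) ∩
    {x | (∀ p, dist (x p) (M.center p.1) ≤ M.radius p.1) ∧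
      ∀ i ℓ ℓ', ℓ ≠ ℓ' → clusterCost x i ℓ ≠ clusterCost x i ℓ'}, ?_,
    (M.measurableSet_concentrated ν tests _).inter (measurableSet_mem_and_clusterCost_ne M ν), ?_⟩
  · rintro x ⟨hx, hball, hties⟩
    refine exactRecovery_of_deviation_le M hnpos hν (W := β * R) (R := R) (κ := κ) (t := t)
      (η := η) (ρ := M.meanDist) (F := fun j p => ∫ q, contribution (α j) p q ∂M.μ j)
      x hκ0 ht0 hη0 hηκ hηβ (fun i => by linarith [hc i]) hR (fun i => ?_) (fun i j hij => ?_)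
      (fun i => ?_) (fun i p hp => ?_) (fun i p hp => ?_) hball (fun i j p hp => ?_)
      (fun i => ?_) hties
    · rw [le_div_iff₀ (hβ0 i), mul_comm]
      gcongr
      exact hβ i
    · have h1 : β * R / M.β j ≤ β * R :=
        div_le_self (mul_nonneg ((hβ0 j).le.trans (hβ j)) hR0.le) (M.one_le_β j)
      linarith [hsep i j hij, M.meanDist_le j, hR j, le_max_right (M.radius i) (M.radius j)]
    · have h1 := M.integral_contribution_center i (α i)
      simp only [hα, add_sub_cancel_left] at h1
      exact h1
    · have h1 := M.integral_contribution_own_le hm hrot i (hR i) (α := α i) (by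
        simp only [hα]
        gcongr
        rw [le_div_iff₀ (hβ0 i), mul_comm]
        gcongr
        exact hβ i) hp
      have h2 : κ * dist p (M.center i) ^ 2 ≤ dist p (M.center i) ^ 2 / (12 * R) := by
        have h3 : dist p (M.center i) ^ 2 / (12 * R) = 2 * (κ * dist p (M.center i) ^ 2) := by
          rw [hκ]; ring
        have h4 : 0 ≤ κ * dist p (M.center i) ^ 2 := by positivity
        linarith
      have h5 : α i = M.meanDist i + β * R / M.β i := rfl
      linarith
    · have h1 := M.sum_integral_contribution_le hm hrot hR hβ hε hεk hsep hp
      have h2 : κ * dist p (M.center i) ^ 2 = dist p (M.center i) ^ 2 / (24 * R) := by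
        rw [hκ]; ring
      rw [h2]
      exact h1
    · have hpT := hT (Set.mem_iUnion.2 ⟨i, Metric.mem_closedBall.2 hp⟩)
      simp only [Set.mem_iUnion, Metric.mem_ball, exists_prop] at hpT
      obtain ⟨p', hp'T, hpp'⟩ := hpT
      refine M.abs_sum_contribution_sub_le x hpp'.le ?_
      have h1 := hx (j, p', α j) (by
        rw [htests, Finset.mem_union]
        left
        exact Finset.mem_image.2 ⟨(j, p'), by simpa using hp'T, rfl⟩)
      exact h1.le.trans (by gcongr; exact min_le_left _ _)
    · have h1 := hx (i, M.center i, η) (by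
        rw [htests, Finset.mem_union]
        right
        exact Finset.mem_image.2 ⟨i, Finset.mem_univ _, rfl⟩)
      by_contra! hfar
      have h2 : ∑ ℓ, contribution η (M.center i) (x ⟨i, ℓ⟩) = 0 :=
        Finset.sum_eq_zero fun ℓ _ => contribution_of_ge (hfar ℓ).le
      have hν0 : (0 : ℝ) < ν i := by exact_mod_cast hnpos.trans_le (hnν i)
      have h3 := (abs_lt.1 h1).1
      dsimp only at h3
      rw [h2] at h3
      have h4 : min (η / 3) e * ν i ≤ ν i * ∫ q, contribution η (M.center i) q ∂M.μ i := by
        rw [mul_comm]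
        gcongr
        exact (min_le_right _ _).trans (he i)
      linarith
  · have h1 : (M.law ν).real (M.concentrated ν tests (min (η / 3) e) ∩
        {x | (∀ p, dist (x p) (M.center p.1) ≤ M.radius p.1) ∧
          ∀ i ℓ ℓ', ℓ ≠ ℓ' → clusterCost x i ℓ ≠ clusterCost x i ℓ'})
        = (M.law ν).real (M.concentrated ν tests (min (η / 3) e)) := by
      refine measureReal_congr ?_
      filter_upwards [M.ae_law_mem_and_clusterCost_ne hm hnull
        (fun i => lt_of_lt_of_le hn2 (hnν i))] with x hx
      exact propext ⟨fun h => h.1, fun h => ⟨h, hx⟩⟩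
    have h2 := hK n hnpos ν hnν
    rw [probReal_compl_eq_one_sub (M.measurableSet_concentrated ν tests _)] at h2
    have h3 : K / n < δ := by
      have hNn : (N : ℝ) < n := by exact_mod_cast (le_max_left N 2).trans_lt hn
      rw [div_lt_iff₀ hn0]
      rw [div_lt_iff₀ hδ.1] at hN
      have := hδ.1
      nlinarith
    rw [h1]
    linarith

end Probability

end KMedian

theorem mainTheorem4 (β r R : ℝ) :
    ∃ C : ℝ, 0 < C ∧ ∀ k m : ℕ, 2 ≤ m → ∀ M : KMedian.ESBM k m,
      M.RotationInvariant → M.PosNearCenter → M.NullOfLebesgueNull →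
      (∀ i, r ≤ M.radius i ∧ M.radius i ≤ R) → (∀ i, M.β i ≤ β) →
      (∀ i j, i ≠ j →
        (1 + β) * R + max (M.radius i) (M.radius j) + C * Real.sqrt (k * Real.log m / m)
          < dist (M.center i) (M.center j)) →
      M.WithHighProbability (fun _ => {x | KMedian.ExactRecovery x}) := by
  -- the square of the constant has to be at least `24 * β * R ^ 2 / log 2`
  refine ⟨6 * (|β| + 1) * (|R| + 1), by positivity, fun k m hm M hrot hpos hnull hR hβ hsep => ?_⟩
  rcases Nat.eq_zero_or_pos k with rfl | hk
  · -- without balls there are no points, and the dual certificate is empty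
    refine fun δ hδ => ⟨0, fun n hn ν hν => ⟨Set.univ, fun x _ => ?_, MeasurableSet.univ, ?_⟩⟩
    · exact KMedian.exactRecovery_of_deviation_le M hn hν (W := 0) (R := 0) (κ := 1) (t := 1)
        (η := 1 / 4) (ρ := fun _ => 0) (F := fun _ _ => 0) x one_pos one_pos (by norm_num)
        (by norm_num) (by simp) (fun i => i.elim0) (fun i => i.elim0) (fun i => i.elim0)
        (fun i => i.elim0) (fun i => i.elim0) (fun i => i.elim0) (fun i => i.elim0)
        (fun p => p.1.elim0) (fun i => i.elim0) (fun i => i.elim0) (fun i => i.elim0)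
    · rw [probReal_univ]
      linarith [hδ.1]
  · have hR0 : 0 < R := (M.radius_pos ⟨0, hk⟩).trans_le (hR _).2
    have hβ0 : 0 < β := by linarith [M.one_le_β ⟨0, hk⟩, hβ ⟨0, hk⟩]
    have hk' : (0 : ℝ) < k := by exact_mod_cast hk
    have hm' : (2 : ℝ) ≤ m := by exact_mod_cast hm
    have hlog : Real.log 2 ≤ Real.log m := Real.log_le_log (by norm_num) hm'
    have hlog2 := Real.log_two_gt_d9
    have hlog0 : 0 < Real.log m := by linarith
    refine M.withHighProbability_exactRecovery hm hrot hpos hnull (fun i => (hR i).2) hβ hR0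
      (ε := 6 * (|β| + 1) * (|R| + 1) * Real.sqrt (k * Real.log m / m)) (by positivity) ?_ hsep
    rw [mul_pow _ (Real.sqrt _), Real.sq_sqrt (by positivity), abs_of_pos hR0, abs_of_pos hβ0]
    have h1 : m * ((6 * (β + 1) * (R + 1)) ^ 2 * (k * Real.log m / m))
        = 36 * Real.log m * ((β + 1) ^ 2 * k * (R + 1) ^ 2) := by
      field_simp
      ring
    have h2 : β * k * R ^ 2 ≤ (β + 1) ^ 2 * k * (R + 1) ^ 2 := by
      gcongr
      · nlinarith
      · linarith
    rw [h1]
    calc 24 * β * k * R ^ 2 = 24 * (β * k * R ^ 2) := by ring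
      _ ≤ 24 * ((β + 1) ^ 2 * k * (R + 1) ^ 2) := by gcongr
      _ ≤ 36 * Real.log m * ((β + 1) ^ 2 * k * (R + 1) ^ 2) := by
        gcongr
        linarith
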